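/- **Model.** Alice holds $x\in\mathcal X$ and Bob holds $y\in\mathcal Y$; they have public randomness $R$ and independent private randomness $R_A, R_B$ (arbitrary probability spaces). In a protocol over a *variable-noise binary symmetric channel with feedback*, the bits received so far and the public randomness determine whether the communication is over and, if not, who transmits next. The transmitter chooses, from the received bits so far, the own input, the public randomness and the own private randomness, a bit $b$ and a crossover probability $p\in[0,\tfrac12]$; both parties then see the received bit, which equals $b$ with probability $1-p$ and $1-b$ with probability $p$ (independently of everything else), but the receiver does not learn $p$. This transmission has energy cost $4(p-\tfrac12)^2$. A protocol over the *noiseless channel* is one in which always $p=0$. Communication may be unbounded, but on every pair of inputs it ends almost surely. Let $\Pi(x,y)$ denote the pair consisting of the public randomness and the transcript (the complete string of received bits) of $\pi$ on inputs $x,y$. A protocol $\phi$ *simulates* $\pi$ if there is a deterministic (measurable) function $g$ such that $g(\Phi(x,y))$ has the same distribution as $\Pi(x,y)$ for all $x\in\mathcal X$, $y\in\mathcal Y$. For a discrete probability distribution $\mu$ on $\mathcal X\times\mathcal Y$, the *distributional energy cost* $\mathrm{EC}_\mu(\phi)$ is the expected sum of the energy costs of all transmitted bits when $(X,Y)\sim\mu$,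 and the *external information cost* is the mutual information $\mathrm{IC}^{\mathrm{ext}}_\mu(\pi)=I(XY;\Pi(X,Y))$, measured in bits (it may be $+\infty$). **Theorem 4.2.** There is a universal constant $C$ such that for every protocol $\pi$ over the noiseless channel, every discrete distribution $\mu$ on the pairs of inputs and every $\varepsilon=\frac1{2n}$ with $n$ a positive integer, there is a protocol $\phi$ over a variable-noise binary symmetric channel with feedback such that $\phi$ simulates $\pi$ and $$\mathrm{EC}_\mu(\phi)\le C\,\bigl(\mathrm{IC}^{\mathrm{ext}}_\mu(\pi)+\varepsilon\bigr).$$ -/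

import Mathlib

open MeasureTheory
open scoped ENNReal NNReal

noncomputable section

namespace VarBSC

/-- What happens next in a protocol: the communication is over, Alice transmits, or Bob transmits. -/
inductive Turn
  | done
  | alice
  | bob
deriving DecidableEq

instance : MeasurableSpace Turn := ⊤

/-- Bit strings form a countable set and carry the discrete σ-algebra. -/
instance : MeasurableSpace (List Bool) := ⊤

/-- One use of the channel by a transmitter: the bit that is sent and the crossover
probability `p ∈ [0, 1/2]` of the binary symmetric channel over which it is sent. -/
abbrev Signal : Type := Bool × Set.Icc (0 : ℝ) (1 / 2)

/-- Probability that the bit `c` is received when the signal `s` is transmitted. -/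
def Signal.recvProb (s : Signal) (c : Bool) : ℝ≥0∞ :=
  if c = s.1 then ENNReal.ofReal (1 - (s.2 : ℝ)) else ENNReal.ofReal (s.2 : ℝ)

/-- Energy cost `4 (p - 1/2)²` of one bit transmitted over the channel with crossover
probability `p`. -/
def Signal.energy (s : Signal) : ℝ≥0∞ :=
  ENNReal.ofReal (4 * ((s.2 : ℝ) - 1 / 2) ^ 2)

/-- A two-party protocol over a variable-noise binary symmetric channel with feedback.
Alice's inputs are in `𝒳` and Bob's in `𝒴`; the public randomness lives in `R`, the private
randomness of Alice and of Bob in `A` and `B`.  A history is the list, in chronological order, of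
the bits *received* so far; because of the feedback both parties know it.  The history and the
public randomness determine whether the communication is over and, if not, who transmits.  The
transmitter chooses the bit and the crossover probability from the history, the own input, the
public randomness and the own private randomness; the receiver only sees the received bit. -/
structure Protocol (𝒳 𝒴 R A B : Type*)
    [MeasurableSpace R] [MeasurableSpace A] [MeasurableSpace B] where
  pub : Measure R
  privA : Measure A
  privB : Measure B
  isProb_pub : IsProbabilityMeasure pub
  isProb_privA : IsProbabilityMeasure privA
  isProb_privB : IsProbabilityMeasure privB
  turn : List Bool → R → Turn
  alice : List Bool → 𝒳 → R × A → Signal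
  bob : List Bool → 𝒴 → R × B → Signal
  measurable_turn : ∀ h, Measurable (turn h)
  measurable_alice : ∀ h x, Measurable (alice h x)
  measurable_bob : ∀ h y, Measurable (bob h y)

namespace Protocol

variable {𝒳 𝒴 R A B : Type*} [MeasurableSpace R] [MeasurableSpace A] [MeasurableSpace B]

/-- A protocol over the noiseless channel: every bit is sent with crossover probability `0`. -/
def IsNoiseless (P : Protocol 𝒳 𝒴 R A B) : Prop :=
  (∀ h x z, ((P.alice h x z).2 : ℝ) = 0) ∧ (∀ h y z, ((P.bob h y z).2 : ℝ) = 0)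

/-- The law of the randomness of the parties: the public string and the two private strings are
independent. -/
def coins (P : Protocol 𝒳 𝒴 R A B) : Measure (R × A × B) :=
  P.pub.prod (P.privA.prod P.privB)

/-- The signal transmitted after the history `h`, or `none` if the communication is over. -/
def signal (P : Protocol 𝒳 𝒴 R A B) (x : 𝒳) (y : 𝒴) (ω : R × A × B) (h : List Bool) :
    Option Signal :=
  match P.turn h ω.1 with
  | Turn.done => none
  | Turn.alice => some (P.alice h x (ω.1, ω.2.1))
  | Turn.bob => some (P.bob h y (ω.1, ω.2.2))

/-- Probability over the channel noise that, after the history `h`, one more bit is transmitted and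
received as `c`. -/
def stepProb (P : Protocol 𝒳 𝒴 R A B) (x : 𝒳) (y : 𝒴) (ω : R × A × B) (h : List Bool)
    (c : Bool) : ℝ≥0∞ :=
  ((P.signal x y ω h).map (fun s => s.recvProb c)).getD 0

/-- Probability over the channel noise that the received bits begin with `w`. -/
def reachProb (P : Protocol 𝒳 𝒴 R A B) (x : 𝒳) (y : 𝒴) (ω : R × A × B) (w : List Bool) :
    ℝ≥0∞ :=
  ∏ i : Fin w.length, P.stepProb x y ω (w.take i) w[i]

/-- Probability over the channel noise that the communication ends exactly with the received bits
`w`. -/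
def haltProb (P : Protocol 𝒳 𝒴 R A B) (x : 𝒳) (y : 𝒴) (ω : R × A × B) (w : List Bool) :
    ℝ≥0∞ :=
  if P.turn w ω.1 = Turn.done then P.reachProb x y ω w else 0

/-- The law, on the inputs `x` and `y`, of the pair of the public randomness and the (complete,
finite) transcript of received bits. -/
def transcriptLaw (P : Protocol 𝒳 𝒴 R A B) (x : 𝒳) (y : 𝒴) : Measure (R × List Bool) :=
  Measure.sum fun w : List Bool =>
    (P.coins.withDensity fun ω => P.haltProb x y ω w).map fun ω => (ω.1, w)

/-- On every pair of inputs the communication is almost surely over after finitely many bits (there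
need not be a bound on their number). -/
def Halts (P : Protocol 𝒳 𝒴 R A B) : Prop :=
  ∀ x y, P.transcriptLaw x y Set.univ = 1

/-- The expected sum of the energy costs of all transmitted bits on the inputs `x` and `y`. -/
def energyCost (P : Protocol 𝒳 𝒴 R A B) (x : 𝒳) (y : 𝒴) : ℝ≥0∞ :=
  ∑' h : List Bool, ∫⁻ ω, P.reachProb x y ω h *
    ((P.signal x y ω h).map Signal.energy).getD 0 ∂P.coins

/-- Distributional energy cost: the expected energy cost for inputs drawn from `μ`. -/
def distEnergyCost (P : Protocol 𝒳 𝒴 R A B) (μ : PMF (𝒳 × 𝒴)) : ℝ≥0∞ :=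
  ∑' xy : 𝒳 × 𝒴, μ xy * P.energyCost xy.1 xy.2

/-- The joint law of the inputs `(X, Y)`, drawn from `μ`, and of the public randomness and the
transcript. -/
def jointLaw [MeasurableSpace 𝒳] [MeasurableSpace 𝒴] (P : Protocol 𝒳 𝒴 R A B)
    (μ : PMF (𝒳 × 𝒴)) : Measure ((𝒳 × 𝒴) × (R × List Bool)) :=
  Measure.sum fun xy : 𝒳 × 𝒴 =>
    μ xy • (P.transcriptLaw xy.1 xy.2).map fun v => (xy, v)

end Protocol

/-- Mutual information, in bits, of two random variables with the joint law `J`: the divergence of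
the joint law from the product of its marginals. -/
def mutualInfo {S V : Type*} [MeasurableSpace S] [MeasurableSpace V] (J : Measure (S × V)) :
    ℝ≥0∞ :=
  InformationTheory.klDiv J ((J.map Prod.fst).prod (J.map Prod.snd)) /
    ENNReal.ofReal (Real.log 2)

namespace Protocol

/-- External information cost: the mutual information `I(XY ; Π)` of the inputs with the public
randomness and the transcript. -/
def extInfoCost {𝒳 𝒴 R A B : Type*} [MeasurableSpace 𝒳] [MeasurableSpace 𝒴]
    [MeasurableSpace R] [MeasurableSpace A] [MeasurableSpace B]
    (P : Protocol 𝒳 𝒴 R A B) (μ : PMF (𝒳 × 𝒴)) : ℝ≥0∞ :=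
  mutualInfo (P.jointLaw μ)

/-- `φ` simulates `π`: a deterministic function `g` maps the public randomness and transcript of
`φ` to a pair distributed as the public randomness and transcript of `π`, on *every* pair of
inputs. -/
def Simulates {𝒳 𝒴 R A B R' A' B' : Type*}
    [MeasurableSpace R] [MeasurableSpace A] [MeasurableSpace B]
    [MeasurableSpace R'] [MeasurableSpace A'] [MeasurableSpace B']
    (φ : Protocol 𝒳 𝒴 R' A' B') (π : Protocol 𝒳 𝒴 R A B) : Prop :=
  ∃ g : R' × List Bool → R × List Bool, Measurable g ∧
    ∀ x y, (φ.transcriptLaw x y).map g = π.transcriptLaw x y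

end Protocol

end VarBSC

end

noncomputable section

namespace VarBSC

/-! ### Sums over the nodes of the binary tree -/

section Lists

/-! Fix the public randomness. The probability of a history is a product of a factor of Alice and a
factor of Bob (`Protocol.lintegral_reachProb`), so whoever transmits next can compute from the own
input the conditional probability `p` that the next bit is `true`. Averaging over `μ` gives a
probability `q` known to both parties, perturbed slightly to lie in `(0, 1)`.

The bit is not sent directly. A fair walk starts at `q` and reads its binary digits: at every step
it either stops at the endpoint named by the digit or continues, and it stops at `1` with
probability `q`. The transmitter biases the steps by the Doob transform with the affine likelihood
ratio that is `p / q` at `1` and `(1 - p) / (1 - q)` at `0`; then the walk stops at `1` with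
probability exactly `p` (`IsWalkSim.visit_zero_snoc`). Both parties follow the walk from the
received bits, so the simulation is exact. The energy of a step is the square of its bias, which a
Pinsker-type inequality bounds by the drop of a potential; telescoping, one bit costs at most `6 *
binKL p q` (`walk_energy_sum_le`).

It remains to sum over histories. Up to the perturbation, the divergence of one bit, weighted by the
probability of the history, is the increment of relative entropy between a node of the transcript
tree and its two children (`mul_binKL_add_relEnt_le`). This telescopes to the relative entropy at
the leaves (`IsFlow.tsum_cost_le`), even with unbounded communication, and the perturbations,
geometric in the depth, add at most `e = ε`. Integrated over the public randomness and averaged over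
`μ`, the relative entropy at the leaves is bounded by the mutual information (`tsum_klDiv_le`). -/

theorem tsum_list_cons (F : List Bool → ℝ≥0∞) :
    ∑' v, F v = F [] + (∑' v, F (false :: v) + ∑' v, F (true :: v)) := by
  let e : Unit ⊕ (Bool × List Bool) ≃ List Bool :=
    { toFun := Sum.elim (fun _ => []) fun p => p.1 :: p.2
      invFun := fun l => match l with
        | [] => Sum.inl ()
        | c :: v => Sum.inr (c, v)
      left_inv := by rintro (_ | ⟨c, v⟩) <;> rfl
      right_inv := by rintro (_ | ⟨c, v⟩) <;> rfl }
  rw [← e.tsum_eq F, Summable.tsum_sum ENNReal.summable ENNReal.summable, tsum_fintype]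
  simp only [e, Equiv.coe_fn_mk, Sum.elim_inl, Sum.elim_inr, Finset.univ_unique,
    Finset.sum_singleton]
  rw [ENNReal.tsum_prod (f := fun c v => F (c :: v)), tsum_bool]

theorem tsum_list_snoc (F : List Bool → ℝ≥0∞) :
    ∑' v, F v = F [] + ∑' v, (F (v ++ [false]) + F (v ++ [true])) := by
  rw [← (List.reverse_involutive.toPerm _).tsum_eq F, tsum_list_cons, ENNReal.tsum_add,
    ← (List.reverse_involutive.toPerm _).tsum_eq (fun v => F (v ++ [false])),
    ← (List.reverse_involutive.toPerm _).tsum_eq (fun v => F (v ++ [true]))]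
  simp [Function.Involutive.toPerm]

/-- Summation bound for a nonnegative supermartingale on the binary tree. -/
theorem tsum_le_of_supermartingale {F B : List Bool → ℝ≥0∞}
    (hF : ∀ h, F h + (B (h ++ [false]) + B (h ++ [true])) ≤ B h) (h : List Bool) :
    ∑' v, F (h ++ v) ≤ B h := by
  have trunc : ∀ (K : ℕ) (h : List Bool),
      ∑' v : List Bool, (if v.length < K then F (h ++ v) else 0) ≤ B h := by
    intro K
    induction K with
    | zero => simp
    | succ K ih =>
      intro h
      rw [tsum_list_cons]
      refine le_trans ?_ (hF h)
      have e : ∀ c : Bool,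
          ∑' v : List Bool, (if (c :: v).length < K + 1 then F (h ++ c :: v) else 0) ≤
            B (h ++ [c]) := by
        intro c
        refine le_trans (le_of_eq ?_) (ih (h ++ [c]))
        simp
      have e0 : (if ([] : List Bool).length < K + 1 then F (h ++ []) else 0) = F h := by simp
      rw [e0]
      exact add_le_add le_rfl (add_le_add (e false) (e true))
  rw [ENNReal.tsum_eq_iSup_sum]
  refine iSup_le fun s => ?_
  refine le_trans (le_trans ?_ (ENNReal.sum_le_tsum s)) (trunc (s.sup List.length + 1) h)
  refine Finset.sum_le_sum fun v hv => ?_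
  rw [if_pos (Nat.lt_succ_of_le (Finset.le_sup hv))]

end Lists

/-! ### Relative entropy of two masses -/

section RelEnt

/-- The pointwise term of the relative entropy of finite measures: `u log (u / m) + m - u`. -/
def relEnt (u m : ℝ) : ℝ := u * Real.log (u / m) + m - u

/-- `relEnt` is convex and homogeneous of degree one, so it lies above its tangent plane along the
ray `u = z * m`, which is the left side. Being linear in `(u, m)`, the bound can be summed over
leaves. The last two hypotheses exclude the cases in which `log 0 = 0` stands for an infinite value.
-/
theorem relEnt_tangent {u m z : ℝ} (hu : 0 ≤ u) (hm : 0 ≤ m) (hz : 0 ≤ z)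
    (hum : m = 0 → u = 0) (huz : z = 0 → u = 0) :
    Real.log z * u + (1 - z) * m ≤ relEnt u m := by
  unfold relEnt
  rcases hu.eq_or_lt with rfl | hu
  · nlinarith
  have hm : 0 < m := hm.lt_of_ne fun h => hu.ne' (hum h.symm)
  have hz : 0 < z := hz.lt_of_ne fun h => hu.ne' (huz h.symm)
  have h1 := Real.one_sub_inv_le_log_of_pos (x := u / (m * z)) (by positivity)
  have h2 : Real.log (u / (m * z)) = Real.log (u / m) - Real.log z := by
    rw [← div_div, Real.log_div (by positivity) hz.ne']
  rw [h2] at h1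
  have h3 := mul_le_mul_of_nonneg_left h1 hu.le
  have h4 : u * (1 - (u / (m * z))⁻¹) = u - m * z := by field_simp
  rw [h4] at h3
  nlinarith

theorem relEnt_nonneg {u m : ℝ} (hu : 0 ≤ u) (hm : 0 ≤ m) (hum : m = 0 → u = 0) :
    0 ≤ relEnt u m := by
  simpa using relEnt_tangent hu hm zero_le_one hum (by simp)

theorem relEnt_eq_tangent {u m : ℝ} (hum : m = 0 → u = 0) :
    Real.log (u / m) * u + (1 - u / m) * m = relEnt u m := by
  unfold relEnt
  by_cases hm : m = 0
  · simp [hm, hum hm]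
  · field_simp
    ring

end RelEnt

/-! ### Flows on the binary tree and the telescoping of relative entropy -/

section Tree

open scoped Classical in
/-- Sum of `F` over the leaves (elements of `D`) below the node `h`. -/
def leafSum (D : List Bool → Prop) (F : List Bool → ℝ≥0∞) (h : List Bool) : ℝ≥0∞ :=
  ∑' v, if D (h ++ v) then F (h ++ v) else 0

variable {D : List Bool → Prop} {F u m : List Bool → ℝ≥0∞}

open scoped Classical in
theorem leafSum_step (h : List Bool) :
    leafSum D F h = (if D h then F h else 0) +
      (leafSum D F (h ++ [false]) + leafSum D F (h ++ [true])) := by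
  rw [leafSum, tsum_list_cons]
  simp [leafSum]

/-- A finite flow on the binary tree that stops at `D`. -/
structure IsFlow (D : List Bool → Prop) (u : List Bool → ℝ≥0∞) : Prop where
  root : u [] = 1
  add : ∀ h, ¬ D h → u (h ++ [false]) + u (h ++ [true]) = u h
  absorb : ∀ h, D h → ∀ c, u (h ++ [c]) = 0

namespace IsFlow

theorem add_le (hu : IsFlow D u) (h : List Bool) :
    u (h ++ [false]) + u (h ++ [true]) ≤ u h := by
  by_cases hD : D h
  · simp [hu.absorb h hD]
  · exact (hu.add h hD).le

theorem snoc_le (hu : IsFlow D u) (h : List Bool) (c : Bool) : u (h ++ [c]) ≤ u h := by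
  refine le_trans ?_ (hu.add_le h)
  cases c
  · exact le_self_add
  · exact le_add_self

theorem le_one (hu : IsFlow D u) (h : List Bool) : u h ≤ 1 := by
  induction h using List.reverseRecOn with
  | nil => exact hu.root.le
  | append_singleton h c ih => exact (hu.snoc_le h c).trans ih

theorem ne_top (hu : IsFlow D u) (h : List Bool) : u h ≠ ∞ :=
  ne_top_of_le_ne_top ENNReal.one_ne_top (hu.le_one h)

theorem append_le (hu : IsFlow D u) (h v : List Bool) : u (h ++ v) ≤ u h := by
  induction v using List.reverseRecOn with
  | nil => simp
  | append_singleton v c ih =>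
    rw [← List.append_assoc]
    exact (hu.snoc_le _ c).trans ih

theorem leafSum_le (hu : IsFlow D u) (h : List Bool) : leafSum D u h ≤ u h := by
  classical
  refine tsum_le_of_supermartingale (F := fun h => if D h then u h else 0) (B := u) ?_ h
  intro h
  by_cases hD : D h
  · simp [hD, hu.absorb h hD]
  · simp [hD, hu.add h hD]

/-- Mass can only be lost along infinite paths. A deficit at a child would be a deficit at its
parent, and so on up to the root, where there is none. -/
theorem leafSum_eq (hu : IsFlow D u) (h0 : leafSum D u [] = 1) (h : List Bool) :
    leafSum D u h = u h := by
  classical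
  induction h using List.reverseRecOn with
  | nil => rw [h0, hu.root]
  | append_singleton h c ih =>
    by_cases hD : D h
    · exact le_antisymm (hu.leafSum_le _) (by simp [hu.absorb h hD])
    · rw [leafSum_step, if_neg hD, zero_add, ← hu.add h hD] at ih
      refine le_antisymm (hu.leafSum_le _) ?_
      have hf := hu.leafSum_le (h ++ [false])
      have ht := hu.leafSum_le (h ++ [true])
      by_contra! hlt
      refine (ne_of_lt ?_) ih
      cases c
      · exact ENNReal.add_lt_add_of_lt_of_le (ne_top_of_le_ne_top (hu.ne_top _) ht) hlt ht
      · exact ENNReal.add_lt_add_of_le_of_lt (ne_top_of_le_ne_top (hu.ne_top _) hf) hf hlt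

/-- Relative entropy does not increase when the leaves below a node are merged. -/
theorem relEnt_le_leafSum (hu : IsFlow D u) (hm : IsFlow D m) (hu0 : leafSum D u [] = 1)
    (hm0 : leafSum D m [] = 1) (hum : ∀ h, m h = 0 → u h = 0) (h : List Bool) :
    ENNReal.ofReal (relEnt (u h).toReal (m h).toReal) ≤
      leafSum D (fun w => ENNReal.ofReal (relEnt (u w).toReal (m w).toReal)) h := by
  classical
  have hum' : ∀ w, (m w).toReal = 0 → (u w).toReal = 0 := by
    intro w hw
    rw [ENNReal.toReal_eq_zero_iff] at hw ⊢
    exact Or.inl (hum w (hw.resolve_right (hm.ne_top w)))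
  -- All leaves below `h` use the tangent plane taken at `h`, where it is exact.
  set z : ℝ := (u h).toReal / (m h).toReal with hz
  have hz0 : 0 ≤ z := by positivity
  set G : List Bool → ℝ≥0∞ := fun w => ENNReal.ofReal (relEnt (u w).toReal (m w).toReal) with hG
  have hGr : ∀ w, 0 ≤ relEnt (u w).toReal (m w).toReal := fun w =>
    relEnt_nonneg ENNReal.toReal_nonneg ENNReal.toReal_nonneg (hum' w)
  have conv : ∀ (a b : ℝ) (w : List Bool), 0 ≤ a → 0 ≤ b →
      ENNReal.ofReal a * u w + ENNReal.ofReal b * m w =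
        ENNReal.ofReal (a * (u w).toReal + b * (m w).toReal) := by
    intro a b w ha hb
    rw [ENNReal.ofReal_add (by positivity) (by positivity), ENNReal.ofReal_mul ha,
      ENNReal.ofReal_mul hb, ENNReal.ofReal_toReal (hu.ne_top w),
      ENNReal.ofReal_toReal (hm.ne_top w)]
  -- The coefficients `log z = c - a` and `1 - z = d - b` are split into positive and negative
  -- parts, so that the tangent inequality can be summed in `ℝ≥0∞`.
  set a := max (-Real.log z) 0
  set c := max (Real.log z) 0
  set b := max (z - 1) 0
  set d := max (1 - z) 0
  have ha : 0 ≤ a := le_max_right _ _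
  have hb : 0 ≤ b := le_max_right _ _
  have hc : 0 ≤ c := le_max_right _ _
  have hd : 0 ≤ d := le_max_right _ _
  have hac : c - a = Real.log z := by
    simp only [a, c]
    rcases le_total 0 (Real.log z) with h | h
    · rw [max_eq_left h, max_eq_right (by linarith)]; ring
    · rw [max_eq_right h, max_eq_left (by linarith)]; ring
  have hbd : d - b = 1 - z := by
    simp only [b, d]
    rcases le_total 1 z with h | h
    · rw [max_eq_left (by linarith : 0 ≤ z - 1), max_eq_right (by linarith)]; ring
    · rw [max_eq_right (by linarith : z - 1 ≤ 0), max_eq_left (by linarith)]; ring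
  have huz : ∀ v, z = 0 → (u (h ++ v)).toReal = 0 := by
    intro v hzz
    have h1 : (u h).toReal = 0 := by
      rcases div_eq_zero_iff.1 (hz.symm.trans hzz) with h1 | h1
      · exact h1
      · exact hum' h h1
    have h2 : u h = 0 := by
      rw [ENNReal.toReal_eq_zero_iff] at h1
      exact h1.resolve_right (hu.ne_top h)
    have h3 := hu.append_le h v
    rw [h2, nonpos_iff_eq_zero] at h3
    simp [h3]
  have key : ∀ v, ENNReal.ofReal c * u (h ++ v) + ENNReal.ofReal d * m (h ++ v) ≤
      G (h ++ v) + (ENNReal.ofReal a * u (h ++ v) + ENNReal.ofReal b * m (h ++ v)) := by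
    intro v
    rw [conv c d _ hc hd, conv a b _ ha hb, hG, ← ENNReal.ofReal_add (hGr _) (by positivity)]
    apply ENNReal.ofReal_le_ofReal
    have := relEnt_tangent (u := (u (h ++ v)).toReal) (m := (m (h ++ v)).toReal) (z := z)
      ENNReal.toReal_nonneg ENNReal.toReal_nonneg hz0 (hum' _) (huz v)
    rw [← hac, ← hbd] at this
    linarith
  have sumkey : ENNReal.ofReal c * leafSum D u h + ENNReal.ofReal d * leafSum D m h ≤
      leafSum D G h + (ENNReal.ofReal a * leafSum D u h + ENNReal.ofReal b * leafSum D m h) := by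
    simp only [leafSum]
    simp only [← ENNReal.tsum_mul_left, ← ENNReal.tsum_add]
    refine ENNReal.tsum_le_tsum fun v => ?_
    by_cases hD : D (h ++ v)
    · simpa [hD] using key v
    · simp [hD]
  rw [hu.leafSum_eq hu0, hm.leafSum_eq hm0, conv c d _ hc hd, conv a b _ ha hb] at sumkey
  have heq : c * (u h).toReal + d * (m h).toReal =
      relEnt (u h).toReal (m h).toReal + (a * (u h).toReal + b * (m h).toReal) := by
    rw [← relEnt_eq_tangent (hum' h), ← hz, ← hac, ← hbd]
    ring
  rw [heq, ENNReal.ofReal_add (hGr h) (by positivity)] at sumkey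
  exact (ENNReal.add_le_add_iff_right ENNReal.ofReal_ne_top).1 sumkey

/-- The total mass at each depth is at most one, so a geometric series dominates. This makes errors
that decay geometrically in the depth summable without a bound on the communication. -/
theorem tsum_geometric_le (hu : IsFlow D u) :
    ∑' h, u h * 2⁻¹ ^ (h.length + 1) ≤ 1 := by
  have h1 := tsum_le_of_supermartingale (F := fun h => u h * 2⁻¹ ^ (h.length + 1))
    (B := fun h => u h * 2⁻¹ ^ h.length) ?_ []
  · simpa [hu.root] using h1
  intro h
  simp only [List.length_append, List.length_singleton]
  calc u h * 2⁻¹ ^ (h.length + 1) + (u (h ++ [false]) * 2⁻¹ ^ (h.length + 1) +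
        u (h ++ [true]) * 2⁻¹ ^ (h.length + 1))
      = u h * 2⁻¹ ^ (h.length + 1) +
        (u (h ++ [false]) + u (h ++ [true])) * 2⁻¹ ^ (h.length + 1) := by ring
    _ ≤ u h * 2⁻¹ ^ (h.length + 1) + u h * 2⁻¹ ^ (h.length + 1) := by
        gcongr
        exact hu.add_le h
    _ = u h * 2⁻¹ ^ h.length * (2⁻¹ + 2⁻¹) := by ring
    _ = u h * 2⁻¹ ^ h.length := by rw [ENNReal.inv_two_add_inv_two, mul_one]

open scoped Classical in
/-- If at each inner node the cost is at most the increment of relative entropy plus an error,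
then the total cost is at most the relative entropy at the leaves plus the total error. -/
theorem tsum_cost_le (hu : IsFlow D u) (hm : IsFlow D m) (hu0 : leafSum D u [] = 1)
    (hm0 : leafSum D m [] = 1) (hum : ∀ h, m h = 0 → u h = 0) {cost err : List Bool → ℝ≥0∞}
    (hcost : ∀ h, ¬ D h → cost h + ENNReal.ofReal (relEnt (u h).toReal (m h).toReal) ≤
      ENNReal.ofReal (relEnt (u (h ++ [false])).toReal (m (h ++ [false])).toReal) +
      ENNReal.ofReal (relEnt (u (h ++ [true])).toReal (m (h ++ [true])).toReal) + err h) :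
    ∑' h, (if D h then 0 else cost h) ≤
      leafSum D (fun w => ENNReal.ofReal (relEnt (u w).toReal (m w).toReal)) [] + ∑' h, err h := by
  set G : List Bool → ℝ≥0∞ := fun w => ENNReal.ofReal (relEnt (u w).toReal (m w).toReal) with hG
  set S : List Bool → ℝ≥0∞ := leafSum D G with hS
  set E : List Bool → ℝ≥0∞ := fun h => ∑' v, err (h ++ v) with hE
  have hGS : ∀ h, G h ≤ S h := hu.relEnt_le_leafSum hm hu0 hm0 hum
  have hB : ∀ h, (S h + E h - G h) + G h = S h + E h := fun h =>
    tsub_add_cancel_of_le ((hGS h).trans le_self_add)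
  have hEstep : ∀ h, E h = err h + (E (h ++ [false]) + E (h ++ [true])) := by
    intro h
    simp only [hE]
    rw [tsum_list_cons]
    simp
  -- The potential is the relative entropy still to be gained below `h` plus the errors still to
  -- come. By `hGS` the subtraction is not truncated; only the finite `G h` is subtracted, so `S h`
  -- and `E h` may be infinite.
  have h1 := tsum_le_of_supermartingale (F := fun h => if D h then 0 else cost h)
    (B := fun h => S h + E h - G h) ?_ []
  · simp only [List.nil_append] at h1
    refine h1.trans (tsub_le_self.trans ?_)
    simp [hE]
  intro h
  refine ENNReal.le_sub_of_add_le_right ENNReal.ofReal_ne_top ?_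
  have hsum : (S (h ++ [false]) + E (h ++ [false]) - G (h ++ [false])) +
      (S (h ++ [true]) + E (h ++ [true]) - G (h ++ [true])) +
      (G (h ++ [false]) + G (h ++ [true])) =
      S (h ++ [false]) + S (h ++ [true]) + (E (h ++ [false]) + E (h ++ [true])) := by
    rw [add_add_add_comm, hB, hB, add_add_add_comm]
  rw [hEstep h, hS, leafSum_step h, ← hS]
  by_cases hD : D h
  · have hzero : ∀ c, S (h ++ [c]) = 0 ∧ G (h ++ [c]) = 0 := by
      intro c
      have hz : ∀ v, G (h ++ [c] ++ v) = 0 := by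
        intro v
        have e1 := hu.append_le (h ++ [c]) v
        have e2 := hm.append_le (h ++ [c]) v
        rw [hu.absorb h hD c, nonpos_iff_eq_zero] at e1
        rw [hm.absorb h hD c, nonpos_iff_eq_zero] at e2
        simp only [hG, e1, e2, relEnt]
        simp
      refine ⟨?_, by simpa using hz []⟩
      simp only [hS, leafSum, hz, ite_self, tsum_zero]
    simp only [hD, if_true, (hzero _).1, (hzero _).2, zero_add, tsub_zero, add_zero]
    rw [add_comm]
    exact add_le_add le_rfl le_add_self
  · simp only [hD, if_false, zero_add]
    calc cost h + (S (h ++ [false]) + E (h ++ [false]) - G (h ++ [false]) +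
          (S (h ++ [true]) + E (h ++ [true]) - G (h ++ [true]))) + G h
        = (cost h + G h) + (S (h ++ [false]) + E (h ++ [false]) - G (h ++ [false]) +
          (S (h ++ [true]) + E (h ++ [true]) - G (h ++ [true]))) := by ring
      _ ≤ (G (h ++ [false]) + G (h ++ [true]) + err h) +
          (S (h ++ [false]) + E (h ++ [false]) - G (h ++ [false]) +
          (S (h ++ [true]) + E (h ++ [true]) - G (h ++ [true]))) := by
          exact add_le_add (hcost h hD) le_rfl
      _ = err h + ((S (h ++ [false]) + E (h ++ [false]) - G (h ++ [false])) +
      (S (h ++ [true]) + E (h ++ [true]) - G (h ++ [true])) +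
      (G (h ++ [false]) + G (h ++ [true]))) := by ring
      _ = _ := by rw [hsum]; ring

end IsFlow

end Tree

open InformationTheory (klFun klFun_nonneg klFun_apply klFun_zero klFun_one convexOn_klFun klDiv
  measurable_klFun)

/-! ### The fair walk that reads binary digits -/

section Digits

/-- Position after `k` steps of the walk that reads off the binary digits of `q`. -/
def pos (q : ℝ) : ℕ → ℝ
  | 0 => q
  | k + 1 => if 1 / 2 ≤ pos q k then 2 * pos q k - 1 else 2 * pos q k

open scoped Classical in
/-- The binary digits of `q ∈ [0, 1)`. -/
def digit (q : ℝ) (k : ℕ) : Bool := decide (1 / 2 ≤ pos q k)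

/-- Probability of the bit `c` if the bit `true` has probability `q`. -/
def bitProb (q : ℝ) (c : Bool) : ℝ := if c then q else 1 - q

theorem pos_mem {q : ℝ} (h0 : 0 ≤ q) (h1 : q < 1) (k : ℕ) : 0 ≤ pos q k ∧ pos q k < 1 := by
  induction k with
  | zero => exact ⟨h0, h1⟩
  | succ k ih =>
    rw [pos]
    split_ifs with h <;> constructor <;> linarith

/-- The fair walk is a martingale: `bitProb 1 (digit q k)` is the endpoint, `1` or `0`, at which it
may stop in step `k`. -/
theorem pos_eq_avg (q : ℝ) (k : ℕ) :
    pos q k = (pos q (k + 1) + bitProb 1 (digit q k)) / 2 := by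
  rw [pos]
  by_cases h : 1 / 2 ≤ pos q k
  · simp only [digit, bitProb, h, if_true, decide_true]
    ring
  · simp only [digit, bitProb, h, if_false, decide_false, Bool.false_eq_true]
    ring

theorem bitProb_nonneg {q : ℝ} (h0 : 0 ≤ q) (h1 : q ≤ 1) (c : Bool) : 0 ≤ bitProb q c := by
  cases c <;> simp [bitProb] <;> linarith

theorem bitProb_pos {q : ℝ} (h0 : 0 < q) (h1 : q < 1) (c : Bool) : 0 < bitProb q c := by
  cases c <;> simp [bitProb] <;> linarith

theorem bitProb_le_one {q : ℝ} (h0 : 0 ≤ q) (h1 : q ≤ 1) (c : Bool) : bitProb q c ≤ 1 := by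
  cases c <;> simp [bitProb] <;> linarith

/-- After `K` steps the fair walk is still running with probability `2⁻¹ ^ K`, and from `pos q K` it
has yet to produce `c` with probability `bitProb (pos q K) c`. -/
theorem sum_digit (q : ℝ) (c : Bool) (K : ℕ) :
    ∑ k ∈ Finset.range K, (if digit q k = c then (2⁻¹ : ℝ) ^ (k + 1) else 0) =
      bitProb q c - 2⁻¹ ^ K * bitProb (pos q K) c := by
  induction K with
  | zero => simp [pos]
  | succ K ih =>
    rw [Finset.sum_range_succ, ih]
    have h := pos_eq_avg q K
    generalize pos q (K + 1) = s at h ⊢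
    rw [h]
    cases hd : digit q K <;> cases c <;> simp [bitProb] <;> ring

theorem hasSum_digit {q : ℝ} (h0 : 0 ≤ q) (h1 : q < 1) (c : Bool) :
    HasSum (fun k => if digit q k = c then (2⁻¹ : ℝ) ^ (k + 1) else 0) (bitProb q c) := by
  rw [hasSum_iff_tendsto_nat_of_nonneg (fun k => by positivity)]
  simp_rw [sum_digit]
  have hlim : Filter.Tendsto (fun K => (2⁻¹ : ℝ) ^ K * bitProb (pos q K) c) Filter.atTop
      (nhds 0) := by
    refine squeeze_zero (fun K => ?_) (fun K => ?_)
      (tendsto_pow_atTop_nhds_zero_of_lt_one (r := (2⁻¹ : ℝ)) (by norm_num) (by norm_num))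
    · exact mul_nonneg (by positivity) (bitProb_nonneg (pos_mem h0 h1 K).1 (pos_mem h0 h1 K).2.le c)
    · exact mul_le_of_le_one_right (by positivity)
        (bitProb_le_one (pos_mem h0 h1 K).1 (pos_mem h0 h1 K).2.le c)
  simpa using hlim.const_sub (bitProb q c)

theorem tsum_digit {q : ℝ} (h0 : 0 ≤ q) (h1 : q < 1) (c : Bool) :
    ∑' k, (if digit q k = c then ENNReal.ofReal ((2⁻¹ : ℝ) ^ (k + 1)) else 0) =
      ENNReal.ofReal (bitProb q c) := by
  have h := hasSum_digit h0 h1 c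
  rw [← h.tsum_eq, ENNReal.ofReal_tsum_of_nonneg (fun k => by positivity) h.summable]
  refine tsum_congr fun k => ?_
  split_ifs <;> simp

theorem measurable_pos (k : ℕ) : Measurable fun q : ℝ => pos q k := by
  induction k with
  | zero => exact measurable_id
  | succ k ih =>
    simp only [pos]
    exact Measurable.ite (measurableSet_le measurable_const ih) (by fun_prop) (by fun_prop)

theorem measurable_digit (k : ℕ) : Measurable fun q : ℝ => digit q k := by
  have h : MeasurableSet {q : ℝ | 1 / 2 ≤ pos q k} :=
    measurableSet_le measurable_const (measurable_pos k)
  refine measurable_to_bool ?_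
  convert! h using 1
  ext q
  simp [digit]

end Digits

/-! ### The biased walk and its energy -/

section Walk

/-- Likelihood ratio, at the position `s`, of the walk conditioned to end in `1` with probability
`p` with respect to the symmetric walk from `q`. -/
def likelihood (p q s : ℝ) : ℝ := p / q * s + (1 - p) / (1 - q) * (1 - s)

/-- Probability of receiving the bit `c` in step `k`: the Doob transform of a fair coin. -/
def walkProb (p q : ℝ) (k : ℕ) (c : Bool) : ℝ :=
  (if digit q k = c then likelihood p q (bitProb 1 c) else likelihood p q (pos q (k + 1))) /
    (2 * likelihood p q (pos q k))

variable {p q : ℝ}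

theorem likelihood_nonneg (hp0 : 0 ≤ p) (hp1 : p ≤ 1) (hq0 : 0 < q) (hq1 : q < 1) {s : ℝ}
    (hs0 : 0 ≤ s) (hs1 : s ≤ 1) : 0 ≤ likelihood p q s := by
  have h1 : 0 ≤ 1 - p := by linarith
  have h2 : 0 < 1 - q := by linarith
  have h3 : 0 ≤ 1 - s := by linarith
  unfold likelihood
  positivity

theorem likelihood_self (hq0 : 0 < q) (hq1 : q < 1) : likelihood p q q = 1 := by
  have h2 : 1 - q ≠ 0 := by linarith
  unfold likelihood
  field_simp
  ring

theorem likelihood_bit (c : Bool) :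
    likelihood p q (bitProb 1 c) = bitProb p c / bitProb q c := by
  cases c <;> simp [likelihood, bitProb]

/-- Affine functions are harmonic for the fair walk. This is what makes the Doob transform
`walkProb` a probability. -/
theorem likelihood_pos (k : ℕ) : likelihood p q (pos q k) =
    (likelihood p q (pos q (k + 1)) + likelihood p q (bitProb 1 (digit q k))) / 2 := by
  have h := pos_eq_avg q k
  generalize pos q (k + 1) = s at h ⊢
  rw [h]
  unfold likelihood
  ring

variable (hp0 : 0 ≤ p) (hp1 : p ≤ 1) (hq0 : 0 < q) (hq1 : q < 1)
include hp0 hp1 hq0 hq1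

theorem likelihood_pos_nonneg (k : ℕ) : 0 ≤ likelihood p q (pos q k) :=
  likelihood_nonneg hp0 hp1 hq0 hq1 (pos_mem hq0.le hq1 k).1 (pos_mem hq0.le hq1 k).2.le

theorem likelihood_bit_nonneg (c : Bool) : 0 ≤ likelihood p q (bitProb 1 c) := by
  rw [likelihood_bit]
  exact div_nonneg (bitProb_nonneg hp0 hp1 c) (bitProb_nonneg hq0.le hq1.le c)

theorem walkProb_nonneg (k : ℕ) (c : Bool) : 0 ≤ walkProb p q k c := by
  unfold walkProb
  have h1 := likelihood_pos_nonneg hp0 hp1 hq0 hq1 k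
  have h2 := likelihood_pos_nonneg hp0 hp1 hq0 hq1 (k + 1)
  have h3 := likelihood_bit_nonneg hp0 hp1 hq0 hq1 c
  split_ifs <;> positivity

omit hp0 hp1 hq0 hq1 in
theorem walkProb_add (k : ℕ) (h : likelihood p q (pos q k) ≠ 0) :
    walkProb p q k true + walkProb p q k false = 1 := by
  unfold walkProb
  rw [← add_div, div_eq_one_iff_eq (by positivity), likelihood_pos (p := p) (q := q) k]
  cases digit q k <;> simp <;> ring

omit hp0 hp1 hq0 hq1 in
theorem walkProb_stay {k : ℕ} {c : Bool} (hc : digit q k ≠ c)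
    (h : likelihood p q (pos q k) ≠ 0) :
    likelihood p q (pos q k) * walkProb p q k c = 2⁻¹ * likelihood p q (pos q (k + 1)) := by
  unfold walkProb
  rw [if_neg hc]
  field_simp

omit hp0 hp1 hq0 hq1 in
theorem walkProb_exit {k : ℕ} {c : Bool} (hc : digit q k = c)
    (h : likelihood p q (pos q k) ≠ 0) :
    likelihood p q (pos q k) * walkProb p q k c = 2⁻¹ * (bitProb p c / bitProb q c) := by
  unfold walkProb
  rw [if_pos hc, likelihood_bit]
  field_simp

/-- Two nonnegative numbers with average zero vanish. Hence where `walkProb` divides by zero, no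
mass arrives and none should leave, and its default value is harmless. -/
theorem likelihood_eq_zero {k : ℕ} (h : likelihood p q (pos q k) = 0) :
    likelihood p q (pos q (k + 1)) = 0 ∧ likelihood p q (bitProb 1 (digit q k)) = 0 := by
  have h1 := likelihood_pos_nonneg hp0 hp1 hq0 hq1 (k + 1)
  have h2 := likelihood_bit_nonneg hp0 hp1 hq0 hq1 (digit q k)
  rw [likelihood_pos] at h
  constructor <;> linarith

omit hp0 hp1 hq0 hq1 in
-- Scaling by the mean reduces the Jensen gap of `klFun` to `klFun (1 + η) + klFun (1 - η)` with `0
-- ≤ η ≤ 1`. The second term is dropped; the first is at least `η ^ 2 / (η + 2)` because `log (1 +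
-- η) ≥ 2 * η / (η + 2)`, whence the factor `3`.
theorem klFun_pinsker {a b : ℝ} (ha : 0 ≤ a) (hb : 0 ≤ b) :
    (a + b) / 2 * ((a - b) / (a + b)) ^ 2 / 3 ≤
      klFun a + klFun b - 2 * klFun ((a + b) / 2) := by
  wlog hab : b ≤ a generalizing a b
  · have := this hb ha (le_of_not_ge hab)
    rw [add_comm b a] at this
    have e : ((b - a) / (a + b)) ^ 2 = ((a - b) / (a + b)) ^ 2 := by
      rw [← neg_sub a b, neg_div, neg_sq]
    rw [e] at this
    linarith
  rcases (add_nonneg ha hb).eq_or_lt with h0 | h0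
  · have ha0 : a = 0 := by linarith
    have hb0 : b = 0 := by linarith
    simp [ha0, hb0, klFun_zero]
    norm_num
  set l := (a + b) / 2 with hl
  set η := (a - b) / (a + b) with hη
  have hl0 : 0 < l := by positivity
  have hη0 : 0 ≤ η := div_nonneg (by linarith) h0.le
  have hη1 : η ≤ 1 := by rw [hη, div_le_one h0]; linarith
  have ea : a = l * (1 + η) := by rw [hl, hη]; field_simp; ring
  have eb : b = l * (1 - η) := by rw [hl, hη]; field_simp; ring
  have hx : η ^ 2 / 3 ≤ klFun (1 + η) := by
    have h1 := Real.le_log_one_add_of_nonneg hη0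
    have h2 : (1 + η) * (2 * η / (η + 2)) - η = η ^ 2 / (η + 2) := by field_simp; ring
    have h3 : η ^ 2 / 3 ≤ η ^ 2 / (η + 2) := by gcongr; linarith
    have h4 : (1 + η) * (2 * η / (η + 2)) ≤ (1 + η) * Real.log (1 + η) := by gcongr
    rw [klFun_apply]
    linarith
  have hy : 0 ≤ klFun (1 - η) := klFun_nonneg (by linarith)
  have hom : ∀ x, klFun (l * x) = l * (klFun x) + x * (l * Real.log l) + 1 - l := by
    intro x
    simp only [klFun_apply]
    by_cases hx0 : x = 0
    · simp [hx0]
    · rw [Real.log_mul hl0.ne' hx0]; ring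
  have e1 : klFun a + klFun b - 2 * klFun l = l * (klFun (1 + η) + klFun (1 - η)) := by
    have h1 := hom 1
    rw [mul_one, klFun_one] at h1
    rw [ea, eb, hom, hom, h1]
    ring
  rw [e1]
  have := mul_le_mul_of_nonneg_left (add_le_add hx hy) hl0.le
  linarith

/-- Binary relative entropy, in nats. -/
def binKL (p q : ℝ) : ℝ := p * Real.log (p / q) + (1 - p) * Real.log ((1 - p) / (1 - q))

omit hp0 hp1 in
theorem binKL_eq_klFun : binKL p q = q * klFun (p / q) + (1 - q) * klFun ((1 - p) / (1 - q)) := by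
  have h2 : 1 - q ≠ 0 := by linarith
  unfold binKL
  simp only [klFun_apply]
  field_simp
  ring

/-- The potential `pot` is the gap between the chord `lin` and `klFun` of the likelihood:
nonnegative by convexity, zero at the endpoints, `binKL p q` at the start. Since `lin` is affine, a
fair step lowers the mean potential by half the Jensen gap of `klFun` at the two successors. With
successor likelihoods `a` and `b` the bias is `(a - b) / (a + b)` up to sign, so `klFun_pinsker`
bounds the energy by `3 * 2` times that drop. -/
theorem walk_energy_sum_le (K : ℕ) :
    ∑ k ∈ Finset.range K, 2⁻¹ ^ k * likelihood p q (pos q k) *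
      (4 * (walkProb p q k true - 1 / 2) ^ 2) ≤ 6 * binKL p q := by
  set lin : ℝ → ℝ := fun s => s * klFun (p / q) + (1 - s) * klFun ((1 - p) / (1 - q)) with hlin
  set pot : ℝ → ℝ := fun s => lin s - klFun (likelihood p q s) with hpot
  have hpot0 : ∀ s, 0 ≤ s → s ≤ 1 → 0 ≤ pot s := by
    intro s hs0 hs1
    have h1 : 0 ≤ 1 - p := by linarith
    have h2 : 0 < 1 - q := by linarith
    have hx : p / q ∈ Set.Ici (0 : ℝ) := Set.mem_Ici.2 (by positivity)
    have hy : (1 - p) / (1 - q) ∈ Set.Ici (0 : ℝ) := Set.mem_Ici.2 (by positivity)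
    have := convexOn_klFun.2 hx hy hs0 (by linarith : 0 ≤ 1 - s) (by ring)
    simp only [smul_eq_mul] at this
    simp only [hpot, hlin, likelihood]
    rw [mul_comm (p / q) s, mul_comm ((1 - p) / (1 - q)) (1 - s)]
    linarith
  have step : ∀ k, likelihood p q (pos q k) * (4 * (walkProb p q k true - 1 / 2) ^ 2) ≤
      6 * (pot (pos q k) - 2⁻¹ * pot (pos q (k + 1))) := by
    intro k
    have hb : lin (bitProb 1 (digit q k)) = klFun (likelihood p q (bitProb 1 (digit q k))) := by
      cases digit q k <;> simp [hlin, bitProb, likelihood]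
    have hl : lin (pos q k) = (lin (pos q (k + 1)) + lin (bitProb 1 (digit q k))) / 2 := by
      have h := pos_eq_avg q k
      generalize pos q (k + 1) = s at h ⊢
      rw [h]
      simp only [hlin]
      ring
    have hL := likelihood_pos (p := p) (q := q) k
    have ha := likelihood_pos_nonneg hp0 hp1 hq0 hq1 (k + 1)
    have hd := likelihood_bit_nonneg hp0 hp1 hq0 hq1 (digit q k)
    have hpin := klFun_pinsker ha hd
    rw [← hL] at hpin
    have heq : likelihood p q (pos q k) * (4 * (walkProb p q k true - 1 / 2) ^ 2) =
        likelihood p q (pos q k) * ((likelihood p q (pos q (k + 1)) -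
          likelihood p q (bitProb 1 (digit q k))) / (likelihood p q (pos q (k + 1)) +
          likelihood p q (bitProb 1 (digit q k)))) ^ 2 := by
      by_cases h0 : likelihood p q (pos q k) = 0
      · simp [h0]
      have hs : likelihood p q (pos q (k + 1)) + likelihood p q (bitProb 1 (digit q k)) ≠ 0 := by
        intro hs
        rw [hs] at hL
        exact h0 (by simpa using hL)
      have e2 : 2 * likelihood p q (pos q k) =
        likelihood p q (pos q (k + 1)) + likelihood p q (bitProb 1 (digit q k)) := by linarith
      congr 1
      unfold walkProb
      rw [e2]
      rw [div_sub_div _ _ hs two_ne_zero, div_pow, div_pow]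
      cases digit q k <;>
        (simp only [if_true, if_false, Bool.false_eq_true]; field_simp; ring)
    rw [heq]
    simp only [hpot]
    rw [hl, hb]
    linarith
  have tele : ∀ K, ∑ k ∈ Finset.range K, 2⁻¹ ^ k * likelihood p q (pos q k) *
      (4 * (walkProb p q k true - 1 / 2) ^ 2) ≤
      6 * (pot (pos q 0) - 2⁻¹ ^ K * pot (pos q K)) := by
    intro K
    induction K with
    | zero => simp
    | succ K ih =>
      rw [Finset.sum_range_succ]
      have := mul_le_mul_of_nonneg_left (step K) (by positivity : (0 : ℝ) ≤ 2⁻¹ ^ K)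
      rw [← mul_assoc] at this
      have e : (2⁻¹ : ℝ) ^ (K + 1) = 2⁻¹ ^ K * 2⁻¹ := pow_succ _ _
      rw [e]
      linarith
  refine (tele K).trans ?_
  have hp : pot (pos q 0) = binKL p q := by
    simp only [hpot, hlin, pos, likelihood_self hq0 hq1, klFun_one, binKL_eq_klFun hq0 hq1]
    ring
  have := mul_nonneg (by positivity : (0 : ℝ) ≤ 2⁻¹ ^ K)
    (hpot0 _ (pos_mem hq0.le hq1 K).1 (pos_mem hq0.le hq1 K).2.le)
  rw [hp]
  linarith

theorem tsum_walk_energy_le :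
    ∑' k, ENNReal.ofReal (2⁻¹ ^ k * likelihood p q (pos q k)) *
      ENNReal.ofReal (4 * (walkProb p q k true - 1 / 2) ^ 2) ≤ ENNReal.ofReal (6 * binKL p q) := by
  refine ENNReal.tsum_le_of_sum_range_le fun K => ?_
  have hn := fun k => likelihood_pos_nonneg hp0 hp1 hq0 hq1 k
  have e : ∀ k, ENNReal.ofReal (2⁻¹ ^ k * likelihood p q (pos q k)) *
      ENNReal.ofReal (4 * (walkProb p q k true - 1 / 2) ^ 2) =
      ENNReal.ofReal (2⁻¹ ^ k * likelihood p q (pos q k) *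
      (4 * (walkProb p q k true - 1 / 2) ^ 2)) := fun k =>
    (ENNReal.ofReal_mul (mul_nonneg (by positivity) (hn k))).symm
  simp_rw [e]
  rw [← ENNReal.ofReal_sum_of_nonneg
    (fun k _ => mul_nonneg (mul_nonneg (by positivity) (hn k)) (by positivity))]
  exact ENNReal.ofReal_le_ofReal (walk_energy_sum_le hp0 hp1 hq0 hq1 K)

end Walk

/-! ### Realising a step of the walk as a channel signal -/

section Measurability

theorem measurable_walkProb (k : ℕ) (c : Bool) :
    Measurable fun z : ℝ × ℝ => walkProb z.1 z.2 k c := by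
  have h1 : ∀ k, Measurable fun z : ℝ × ℝ => pos z.2 k := fun k =>
    (measurable_pos k).comp measurable_snd
  have h2 : Measurable fun z : ℝ × ℝ => digit z.2 k := (measurable_digit k).comp measurable_snd
  have h1k := h1 k
  have h1k' := h1 (k + 1)
  unfold walkProb likelihood
  refine Measurable.div (Measurable.ite (h2 (measurableSet_singleton c)) ?_ ?_) ?_ <;> fun_prop

end Measurability

section Signals

/-- The signal that is received as `true` with probability `θ ∈ [0, 1]`. -/
def signalOfProb (θ : ℝ) : Signal :=
  if 1 / 2 ≤ θ then (true, Set.projIcc 0 (1 / 2) (by norm_num) (1 - θ))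
  else (false, Set.projIcc 0 (1 / 2) (by norm_num) θ)

theorem measurable_signalOfProb : Measurable signalOfProb := by
  unfold signalOfProb
  refine Measurable.ite measurableSet_Ici ?_ ?_
  · exact measurable_const.prodMk
      (continuous_projIcc.measurable.comp (measurable_const.sub measurable_id))
  · exact measurable_const.prodMk continuous_projIcc.measurable

theorem recvProb_signalOfProb {θ : ℝ} (h0 : 0 ≤ θ) (h1 : θ ≤ 1) (c : Bool) :
    (signalOfProb θ).recvProb c = ENNReal.ofReal (bitProb θ c) := by
  unfold signalOfProb Signal.recvProb bitProb
  by_cases h : 1 / 2 ≤ θ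
  · rw [if_pos h, Set.projIcc_of_mem _ ⟨by linarith, by linarith⟩]
    cases c <;> simp
  · rw [if_neg h, Set.projIcc_of_mem _ ⟨by linarith, by linarith⟩]
    cases c <;> simp

theorem energy_signalOfProb {θ : ℝ} (h0 : 0 ≤ θ) (h1 : θ ≤ 1) :
    (signalOfProb θ).energy = ENNReal.ofReal (4 * (θ - 1 / 2) ^ 2) := by
  unfold signalOfProb Signal.energy
  split_ifs with h
  · rw [Set.projIcc_of_mem _ ⟨by linarith, by linarith⟩]
    congr 1
    ring
  · rw [Set.projIcc_of_mem _ ⟨by linarith, by linarith⟩]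

end Signals

/-! ### Successive walks and the law of their outcomes -/

section WalkState

variable (q : List Bool → ℝ)

/-- A bit either finishes the current walk, with that bit as its outcome, or prolongs it. -/
def nextState (s : List Bool × ℕ) (c : Bool) : List Bool × ℕ :=
  if digit (q s.1) s.2 = c then (s.1 ++ [c], 0) else (s.1, s.2 + 1)

/-- The outcomes of the finished walks, and the number of steps of the current walk, after the
received bits `l`; the walk after the outcomes `h` starts at `q h`. -/
def walkState (l : List Bool) : List Bool × ℕ := l.foldl (nextState q) ([], 0)

@[simp] theorem walkState_nil : walkState q [] = ([], 0) := rfl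

@[simp] theorem walkState_snoc (l : List Bool) (c : Bool) :
    walkState q (l ++ [c]) = nextState q (walkState q l) c := by
  simp [walkState, List.foldl_append]

end WalkState

/-- The data of a simulation by walks: the process `ρ` on received bits moves, in the state
`(h, k)`, according to `walkProb (p h) (q h) k`, and `u` is the law of the outcomes. -/
structure IsWalkSim (D : List Bool → Prop) (p q : List Bool → ℝ) (u ρ : List Bool → ℝ≥0∞) :
    Prop where
  p_nonneg : ∀ h, 0 ≤ p h
  p_le_one : ∀ h, p h ≤ 1
  q_pos : ∀ h, 0 < q h
  q_lt_one : ∀ h, q h < 1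
  u_nil : u [] = 1
  u_snoc : ∀ h, ¬ D h → ∀ c, u (h ++ [c]) = u h * ENNReal.ofReal (bitProb (p h) c)
  u_absorb : ∀ h, D h → ∀ c, u (h ++ [c]) = 0
  ρ_nil : ρ [] = 1
  ρ_snoc : ∀ l, ¬ D (walkState q l).1 → ∀ c, ρ (l ++ [c]) = ρ l *
    (signalOfProb (walkProb (p (walkState q l).1) (q (walkState q l).1)
      (walkState q l).2 true)).recvProb c
  ρ_absorb : ∀ l, D (walkState q l).1 → ∀ c, ρ (l ++ [c]) = 0

namespace IsWalkSim

variable {D : List Bool → Prop} {p q : List Bool → ℝ} {u ρ : List Bool → ℝ≥0∞}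

open scoped Classical in
/-- Probability that the state is ever `s`. -/
def visit (q : List Bool → ℝ) (ρ : List Bool → ℝ≥0∞) (s : List Bool × ℕ) : ℝ≥0∞ :=
  ∑' l, if walkState q l = s then ρ l else 0

theorem tsum_walkState (F : List Bool × ℕ → ℝ≥0∞) :
    ∑' l, ρ l * F (walkState q l) = ∑' s, visit q ρ s * F s := by
  classical
  simp only [visit, ← ENNReal.tsum_mul_right]
  rw [ENNReal.tsum_comm]
  refine tsum_congr fun l => ?_
  rw [tsum_eq_single (walkState q l)]
  · simp
  · intro s hs
    simp [hs.symm]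

open scoped Classical in
/-- Transition probability of the bit `c` in the state `s`. -/
def trans (D : List Bool → Prop) (p q : List Bool → ℝ) (s : List Bool × ℕ) (c : Bool) : ℝ≥0∞ :=
  if D s.1 then 0 else (signalOfProb (walkProb (p s.1) (q s.1) s.2 true)).recvProb c

variable (H : IsWalkSim D p q u ρ)
include H

theorem ρ_step (l : List Bool) (c : Bool) :
    ρ (l ++ [c]) = ρ l * trans D p q (walkState q l) c := by
  unfold trans
  split_ifs with hD
  · rw [H.ρ_absorb l hD, mul_zero]
  · exact H.ρ_snoc l hD c

open scoped Classical in
-- The forward equation, obtained by splitting off the last received bit. No state repeats along a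
-- path, so summing over histories counts each visit once.
theorem visit_eq (s' : List Bool × ℕ) :
    visit q ρ s' = (if s' = ([], 0) then 1 else 0) + ∑' s, visit q ρ s *
      ((if nextState q s false = s' then trans D p q s false else 0) +
        (if nextState q s true = s' then trans D p q s true else 0)) := by
  rw [← tsum_walkState, visit, tsum_list_snoc]
  congr 1
  · simp [H.ρ_nil, eq_comm]
  · refine tsum_congr fun l => ?_
    simp only [walkState_snoc, H.ρ_step, mul_add, mul_ite, mul_zero]

theorem visit_root : visit q ρ ([], 0) = 1 := by
  classical
  rw [H.visit_eq, if_pos rfl]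
  have : ∀ s c, nextState q s c ≠ ([], 0) := by
    intro s c
    unfold nextState
    split_ifs <;> simp
  simp [this]

theorem visit_succ (h : List Bool) (k : ℕ) :
    visit q ρ (h, k + 1) = visit q ρ (h, k) * trans D p q (h, k) (!digit (q h) k) := by
  classical
  rw [H.visit_eq, if_neg (by simp), zero_add, tsum_eq_single (h, k)]
  · unfold nextState
    cases digit (q h) k <;> simp
  · intro s hs
    have : ∀ c, nextState q s c ≠ (h, k + 1) := by
      intro c
      unfold nextState
      split_ifs
      · simp
      · rintro he
        simp only [Prod.mk.injEq, add_left_inj] at he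
        exact hs (Prod.ext he.1 he.2)
    simp [this]

theorem visit_snoc (h : List Bool) (c : Bool) :
    visit q ρ (h ++ [c], 0) =
      ∑' k, if digit (q h) k = c then visit q ρ (h, k) * trans D p q (h, k) c else 0 := by
  classical
  rw [H.visit_eq, if_neg (by simp), zero_add]
  have e : ∀ s : List Bool × ℕ, visit q ρ s *
      ((if nextState q s false = (h ++ [c], 0) then trans D p q s false else 0) +
        (if nextState q s true = (h ++ [c], 0) then trans D p q s true else 0)) =
      if s.1 = h ∧ digit (q s.1) s.2 = c then visit q ρ s * trans D p q s c else 0 := by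
    intro s
    have hn : ∀ c', nextState q s c' = (h ++ [c], 0) ↔
        (s.1 = h ∧ digit (q s.1) s.2 = c) ∧ c' = c := by
      intro c'
      unfold nextState
      split_ifs with hd
      · simp only [Prod.mk.injEq, and_true, List.append_singleton_inj]
        grind
      · simp only [Prod.mk.injEq, Nat.add_eq_zero_iff, one_ne_zero, and_false, false_iff]
        grind
    simp only [hn]
    by_cases hs : s.1 = h ∧ digit (q s.1) s.2 = c
    · cases c <;> simp [hs]
    · simp [hs]
  simp only [e]
  rw [ENNReal.tsum_prod (f := fun h' k => if h' = h ∧ digit (q h') k = c then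
    visit q ρ (h', k) * trans D p q (h', k) c else 0), tsum_eq_single h]
  · simp
  · intro h' hh
    simp [hh]

theorem trans_eq {h : List Bool} (hD : ¬ D h) (k : ℕ) (c : Bool)
    (hl : likelihood (p h) (q h) (pos (q h) k) ≠ 0) :
    trans D p q (h, k) c = ENNReal.ofReal (walkProb (p h) (q h) k c) := by
  have h1 := walkProb_add k hl
  have h2 := walkProb_nonneg (H.p_nonneg h) (H.p_le_one h) (H.q_pos h) (H.q_lt_one h) k true
  have h3 := walkProb_nonneg (H.p_nonneg h) (H.p_le_one h) (H.q_pos h) (H.q_lt_one h) k false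
  unfold trans
  rw [if_neg hD, recvProb_signalOfProb h2 (by linarith)]
  congr 1
  cases c <;> simp [bitProb]
  linarith

/-- The likelihoods in successive Doob factors cancel: what remains is the survival probability of
the fair walk times the current likelihood. -/
theorem visit_walk {h : List Bool} (hD : ¬ D h) (k : ℕ) :
    visit q ρ (h, k) = visit q ρ (h, 0) *
      ENNReal.ofReal (2⁻¹ ^ k * likelihood (p h) (q h) (pos (q h) k)) := by
  induction k with
  | zero => simp [pos, likelihood_self (H.q_pos h) (H.q_lt_one h)]
  | succ k ih =>
    rw [H.visit_succ, ih]
    by_cases hl : likelihood (p h) (q h) (pos (q h) k) = 0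
    · simp [hl, (likelihood_eq_zero (H.p_nonneg h) (H.p_le_one h) (H.q_pos h) (H.q_lt_one h) hl).1]
    · rw [H.trans_eq hD k _ hl, mul_assoc, ← ENNReal.ofReal_mul (mul_nonneg (by positivity)
        (likelihood_pos_nonneg (H.p_nonneg h) (H.p_le_one h) (H.q_pos h) (H.q_lt_one h) k)),
        mul_assoc, walkProb_stay (by simp) hl]
      ring_nf

/-- Every exit to the endpoint `c` has its fair probability multiplied by the same ratio `bitProb (p
h) c / bitProb (q h) c`. The fair exits to `c` sum to `bitProb (q h) c` by `tsum_digit`, which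
cancels the denominator. -/
theorem visit_zero_snoc {h : List Bool} (hD : ¬ D h) (c : Bool) :
    visit q ρ (h ++ [c], 0) = visit q ρ (h, 0) * ENNReal.ofReal (bitProb (p h) c) := by
  have hq := bitProb_pos (H.q_pos h) (H.q_lt_one h) c
  have hp := bitProb_nonneg (H.p_nonneg h) (H.p_le_one h) c
  rw [H.visit_snoc]
  have e : ∀ k, (if digit (q h) k = c then visit q ρ (h, k) * trans D p q (h, k) c else 0) =
      visit q ρ (h, 0) * ENNReal.ofReal (bitProb (p h) c / bitProb (q h) c) *
        (if digit (q h) k = c then ENNReal.ofReal ((2⁻¹ : ℝ) ^ (k + 1)) else 0) := by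
    intro k
    split_ifs with hd
    · rw [H.visit_walk hD]
      by_cases hl : likelihood (p h) (q h) (pos (q h) k) = 0
      · have := (likelihood_eq_zero (H.p_nonneg h) (H.p_le_one h) (H.q_pos h) (H.q_lt_one h) hl).2
        rw [hd, likelihood_bit] at this
        simp [hl, this]
      · rw [H.trans_eq hD k _ hl, mul_assoc, ← ENNReal.ofReal_mul (mul_nonneg (by positivity)
          (likelihood_pos_nonneg (H.p_nonneg h) (H.p_le_one h) (H.q_pos h) (H.q_lt_one h) k)),
          mul_assoc (2⁻¹ ^ k), walkProb_exit hd hl, mul_assoc,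
          ← ENNReal.ofReal_mul (by positivity)]
        ring_nf
    · simp
  simp only [e, ENNReal.tsum_mul_left]
  rw [tsum_digit (H.q_pos h).le (H.q_lt_one h), mul_assoc, ← ENNReal.ofReal_mul (by positivity),
    div_mul_cancel₀ _ hq.ne']

theorem visit_zero (h : List Bool) : visit q ρ (h, 0) = u h := by
  induction h using List.reverseRecOn with
  | nil => rw [H.visit_root, H.u_nil]
  | append_singleton h c ih =>
    by_cases hD : D h
    · rw [H.visit_snoc, H.u_absorb h hD]
      simp [trans, hD]
    · rw [H.visit_zero_snoc hD, ih, H.u_snoc h hD]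

/-- The outcomes are distributed as prescribed. -/
theorem tsum_halt {h : List Bool} (hD : D h) [∀ l, Decidable ((walkState q l).1 = h)] :
    ∑' l, (if (walkState q l).1 = h then ρ l else 0) = u h := by
  classical
  have e : ∀ l, (if (walkState q l).1 = h then ρ l else 0) =
      ρ l * (fun s : List Bool × ℕ => if s.1 = h then 1 else 0) (walkState q l) := by
    intro l
    simp
  rw [tsum_congr e, tsum_walkState (F := fun s => if s.1 = h then 1 else 0),
    tsum_eq_single (h, 0)]
  · simp [H.visit_zero]
  · rintro ⟨h', k⟩ hs
    by_cases hh : h' = h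
    · subst hh
      cases k with
      | zero => exact absurd rfl hs
      | succ k => simp [H.visit_succ, trans, hD]
    · simp [hh]

open scoped Classical in
-- Grouped by state, the energy is that of one walk for each outcome string `h`; this walk is
-- started with probability `u h` and costs at most `6 * binKL (p h) (q h)`.
theorem tsum_energy_le :
    ∑' l, ρ l * (if D (walkState q l).1 then 0 else
      (signalOfProb (walkProb (p (walkState q l).1) (q (walkState q l).1)
        (walkState q l).2 true)).energy) ≤
    ∑' h, if D h then 0 else u h * ENNReal.ofReal (6 * binKL (p h) (q h)) := by
  rw [tsum_walkState (F := fun s => if D s.1 then 0 else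
    (signalOfProb (walkProb (p s.1) (q s.1) s.2 true)).energy),
    ENNReal.tsum_prod (f := fun h k => visit q ρ (h, k) * (if D h then 0 else
    (signalOfProb (walkProb (p h) (q h) k true)).energy))]
  refine ENNReal.tsum_le_tsum fun h => ?_
  split_ifs with hD
  · simp
  rw [← H.visit_zero h]
  refine le_trans (le_of_eq ?_) (mul_le_mul_right (tsum_walk_energy_le (H.p_nonneg h)
    (H.p_le_one h) (H.q_pos h) (H.q_lt_one h)) _)
  rw [← ENNReal.tsum_mul_left]
  refine tsum_congr fun k => ?_
  rw [H.visit_walk hD, mul_assoc]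
  by_cases hl : likelihood (p h) (q h) (pos (q h) k) = 0
  · simp [hl]
  have h1 := walkProb_add k hl
  have h2 := walkProb_nonneg (H.p_nonneg h) (H.p_le_one h) (H.q_pos h) (H.q_lt_one h) k true
  have h3 := walkProb_nonneg (H.p_nonneg h) (H.p_le_one h) (H.q_pos h) (H.q_lt_one h) k false
  rw [energy_signalOfProb h2 (by linarith)]

end IsWalkSim

/-! ### Products of one-step probabilities along a history -/

section PathProd

/-- Product of the one-step weights `f` along the bits of `w`. -/
def pathProd (f : List Bool → Bool → ℝ≥0∞) (w : List Bool) : ℝ≥0∞ :=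
  ∏ i : Fin w.length, f (w.take i) w[i]

theorem pathProd_eq_range (f : List Bool → Bool → ℝ≥0∞) (w : List Bool) :
    pathProd f w = ∏ i ∈ Finset.range w.length, f (w.take i) (w.getD i false) := by
  rw [Finset.prod_range, pathProd]
  refine Finset.prod_congr rfl fun i _ => ?_
  simp

@[simp] theorem pathProd_nil (f : List Bool → Bool → ℝ≥0∞) : pathProd f [] = 1 := by
  simp [pathProd]

@[simp] theorem pathProd_snoc (f : List Bool → Bool → ℝ≥0∞) (w : List Bool) (c : Bool) :
    pathProd f (w ++ [c]) = pathProd f w * f w c := by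
  rw [pathProd_eq_range, pathProd_eq_range, List.length_append, List.length_singleton,
    Finset.prod_range_succ]
  congr 1
  · refine Finset.prod_congr rfl fun i hi => ?_
    have hi := Finset.mem_range.1 hi
    rw [List.take_append_of_le_length hi.le]
    simp [List.getElem?_append_left hi]
  · simp

theorem pathProd_mul (f g : List Bool → Bool → ℝ≥0∞) (w : List Bool) :
    pathProd (fun h c => f h c * g h c) w = pathProd f w * pathProd g w :=
  Finset.prod_mul_distrib

theorem measurable_pathProd {Ω : Type*} [MeasurableSpace Ω] {f : Ω → List Bool → Bool → ℝ≥0∞}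
    (hf : ∀ h c, Measurable fun ω => f ω h c) (w : List Bool) :
    Measurable fun ω => pathProd (f ω) w :=
  Finset.measurable_prod _ fun _ _ => hf _ _

end PathProd

section Signals

theorem Signal.recvProb_add (s : Signal) : s.recvProb false + s.recvProb true = 1 := by
  obtain ⟨b, p, h0, h1⟩ := s
  have e : ENNReal.ofReal (1 - p) + ENNReal.ofReal p = 1 := by
    rw [← ENNReal.ofReal_add (by linarith) h0]
    simp
  cases b
  · simpa [Signal.recvProb] using e
  · rw [add_comm]
    simpa [Signal.recvProb] using e

theorem Signal.measurable_recvProb (c : Bool) : Measurable fun s : Signal => s.recvProb c := by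
  unfold Signal.recvProb
  exact Measurable.ite (measurableSet_eq_fun measurable_const measurable_fst)
    (by fun_prop) (by fun_prop)

theorem Signal.measurable_energy : Measurable Signal.energy := by
  unfold Signal.energy
  fun_prop

end Signals

/-- Serves for strategies evaluated at the walk state, which varies with the public randomness but
has countably many values. -/
theorem measurable_comp_of_countable {R S T : Type*} [MeasurableSpace R] [MeasurableSpace S]
    [MeasurableSpace T] [Countable S] [MeasurableSingletonClass S] {f : R → S} (hf : Measurable f)
    {g : S → R → T} (hg : ∀ s, Measurable (g s)) : Measurable fun r => g (f r) r :=
  (measurable_from_prod_countable_right (f := fun p : S × R => g p.1 p.2) hg).comp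
    (hf.prodMk measurable_id)

instance : DiscreteMeasurableSpace Turn := ⟨fun _ => trivial⟩

instance : DiscreteMeasurableSpace (List Bool) := ⟨fun _ => trivial⟩

/-! ### One party's factor in the probability of a history -/

section Party

variable {R S : Type*} (turn : List Bool → R → Turn) (t : Turn)
  (sig : List Bool → R × S → Signal)

/-- Contribution of one party, who transmits in the turns `t`, to the probability that the bit `c`
is received after `h`. -/
def partyStep (z : R × S) (h : List Bool) (c : Bool) : ℝ≥0∞ :=
  if turn h z.1 = Turn.done then 0 else if turn h z.1 = t then (sig h z).recvProb c else 1

variable [MeasurableSpace S] (ν : Measure S)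

/-- Contribution of one party to the probability of the history `h`, averaged over the private
randomness. -/
def partyReach (r : R) (h : List Bool) : ℝ≥0∞ :=
  ∫⁻ a, pathProd (partyStep turn t sig (r, a)) h ∂ν

/-- Conditional probability that the party transmits `true` after the history `h`. -/
def partyBit (r : R) (h : List Bool) : ℝ :=
  (partyReach turn t sig ν r (h ++ [true]) / partyReach turn t sig ν r h).toReal

variable {turn t sig ν}

theorem partyReach_nil [IsProbabilityMeasure ν] (r : R) : partyReach turn t sig ν r [] = 1 := by
  simp [partyReach]

theorem partyReach_absorb {r : R} {h : List Bool} (hD : turn h r = Turn.done) (c : Bool) :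
    partyReach turn t sig ν r (h ++ [c]) = 0 := by
  simp [partyReach, partyStep, hD]

theorem partyReach_pass {r : R} {h : List Bool} (hD : turn h r ≠ Turn.done) (ht : turn h r ≠ t)
    (c : Bool) : partyReach turn t sig ν r (h ++ [c]) = partyReach turn t sig ν r h := by
  simp [partyReach, partyStep, hD, ht]

theorem partyBit_nonneg (r : R) (h : List Bool) : 0 ≤ partyBit turn t sig ν r h :=
  ENNReal.toReal_nonneg

variable [MeasurableSpace R]

theorem measurable_partyStep (hturn : ∀ h, Measurable (turn h)) (hsig : ∀ h, Measurable (sig h))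
    (h : List Bool) (c : Bool) : Measurable fun z : R × S => partyStep turn t sig z h c := by
  unfold partyStep
  have h1 : Measurable fun z : R × S => turn h z.1 := (hturn h).comp measurable_fst
  exact Measurable.ite (h1 (measurableSet_singleton _)) measurable_const
    (Measurable.ite (h1 (measurableSet_singleton _))
      ((Signal.measurable_recvProb c).comp (hsig h)) measurable_const)

theorem measurable_partyReach [SFinite ν] (hturn : ∀ h, Measurable (turn h))
    (hsig : ∀ h, Measurable (sig h)) (h : List Bool) :
    Measurable fun r => partyReach turn t sig ν r h :=
  (measurable_pathProd (fun h c => measurable_partyStep hturn hsig h c) h).lintegral_prod_right'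

theorem measurable_partyBit [SFinite ν] (hturn : ∀ h, Measurable (turn h))
    (hsig : ∀ h, Measurable (sig h)) (h : List Bool) :
    Measurable fun r => partyBit turn t sig ν r h :=
  ((measurable_partyReach hturn hsig _).div (measurable_partyReach hturn hsig _)).ennreal_toReal

theorem partyReach_add (hturn : ∀ h, Measurable (turn h)) (hsig : ∀ h, Measurable (sig h))
    {r : R} {h : List Bool} (hD : turn h r ≠ Turn.done) (ht : turn h r = t) :
    partyReach turn t sig ν r (h ++ [false]) + partyReach turn t sig ν r (h ++ [true]) =
      partyReach turn t sig ν r h := by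
  unfold partyReach
  have hm : Measurable fun a => pathProd (partyStep turn t sig (r, a)) (h ++ [false]) :=
    (measurable_pathProd (fun h c => measurable_partyStep hturn hsig h c) _).comp
      measurable_prodMk_left
  rw [← lintegral_add_left hm]
  refine lintegral_congr fun a => ?_
  simp only [pathProd_snoc, ← mul_add]
  simp only [partyStep, if_neg hD, if_pos ht, Signal.recvProb_add, mul_one]

theorem partyReach_snoc_le (hturn : ∀ h, Measurable (turn h)) (hsig : ∀ h, Measurable (sig h))
    (r : R) (h : List Bool) (c : Bool) :
    partyReach turn t sig ν r (h ++ [c]) ≤ partyReach turn t sig ν r h := by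
  by_cases hD : turn h r = Turn.done
  · rw [partyReach_absorb hD]
    exact zero_le
  · by_cases ht : turn h r = t
    · rw [← partyReach_add hturn hsig hD ht]
      cases c
      · exact le_self_add
      · exact le_add_self
    · exact (partyReach_pass hD ht c).le

theorem partyReach_ne_top [IsProbabilityMeasure ν] (hturn : ∀ h, Measurable (turn h))
    (hsig : ∀ h, Measurable (sig h)) (r : R) (h : List Bool) :
    partyReach turn t sig ν r h ≠ ∞ := by
  induction h using List.reverseRecOn with
  | nil => simp [partyReach_nil]
  | append_singleton h c ih => exact ne_top_of_le_ne_top ih (partyReach_snoc_le hturn hsig r h c)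

theorem partyBit_le_one (hturn : ∀ h, Measurable (turn h)) (hsig : ∀ h, Measurable (sig h))
    (r : R) (h : List Bool) : partyBit turn t sig ν r h ≤ 1 :=
  ENNReal.toReal_le_of_le_ofReal zero_le_one
    (by simpa using
      ENNReal.div_le_of_le_mul (by simpa using partyReach_snoc_le hturn hsig r h true))

/-- The product rule for the conditional probability `partyBit`. If the history has factor zero, so
has its extension, and the value of `0 / 0` does not matter. -/
theorem partyReach_snoc [IsProbabilityMeasure ν] (hturn : ∀ h, Measurable (turn h))
    (hsig : ∀ h, Measurable (sig h)) {r : R} {h : List Bool} (hD : turn h r ≠ Turn.done)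
    (ht : turn h r = t) (c : Bool) :
    partyReach turn t sig ν r (h ++ [c]) =
      partyReach turn t sig ν r h * ENNReal.ofReal (bitProb (partyBit turn t sig ν r h) c) := by
  have hadd := partyReach_add (ν := ν) hturn hsig hD ht
  have hT := partyReach_ne_top (t := t) (ν := ν) hturn hsig r h
  have hle := partyReach_snoc_le (t := t) (ν := ν) hturn hsig r h
  by_cases h0 : partyReach turn t sig ν r h = 0
  · have := hle c
    rw [h0] at this ⊢
    simpa using this
  have e1 : partyReach turn t sig ν r (h ++ [true]) =
      partyReach turn t sig ν r h * ENNReal.ofReal (partyBit turn t sig ν r h) := by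
    unfold partyBit
    rw [ENNReal.ofReal_toReal (ENNReal.div_ne_top (ne_top_of_le_ne_top hT (hle true)) h0),
      ENNReal.mul_div_cancel h0 hT]
  cases c
  · have hb1 := partyBit_le_one (t := t) (ν := ν) hturn hsig r h
    have hb0 := partyBit_nonneg (turn := turn) (t := t) (sig := sig) (ν := ν) r h
    have h1 : partyReach turn t sig ν r h =
        partyReach turn t sig ν r h * ENNReal.ofReal (1 - partyBit turn t sig ν r h) +
        partyReach turn t sig ν r h * ENNReal.ofReal (partyBit turn t sig ν r h) := by
      rw [← mul_add, ← ENNReal.ofReal_add (by linarith) hb0]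
      simp
    rw [← e1] at h1
    nth_rewrite 1 [← hadd] at h1
    exact (ENNReal.add_left_inj (ne_top_of_le_ne_top hT (hle true))).1 h1
  · exact e1

end Party

/-! ### Laws with a density for each transcript -/

section PubLaw

variable {R : Type*} [MeasurableSpace R]

/-- The law on `R × List Bool` whose part with second component `w` has density `f w`. -/
def pubLaw (ν : Measure R) (f : List Bool → R → ℝ≥0∞) : Measure (R × List Bool) :=
  Measure.sum fun w => (ν.withDensity (f w)).map fun r => (r, w)

theorem lintegral_pubLaw {ν : Measure R} {f : List Bool → R → ℝ≥0∞} (hf : ∀ w, Measurable (f w))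
    {G : R × List Bool → ℝ≥0∞} (hG : Measurable G) :
    ∫⁻ v, G v ∂(pubLaw ν f) = ∫⁻ r, ∑' w, f w r * G (r, w) ∂ν := by
  have hGw : ∀ w, Measurable fun r => G (r, w) := fun w => hG.comp measurable_prodMk_right
  have hm : ∀ w, AEMeasurable (fun r => f w r * G (r, w)) ν := fun w =>
    ((hf w).mul (hGw w)).aemeasurable
  rw [pubLaw, lintegral_sum_measure, lintegral_tsum hm]
  refine tsum_congr fun w => ?_
  rw [lintegral_map hG measurable_prodMk_right,
    lintegral_withDensity_eq_lintegral_mul _ (hf w) (hGw w)]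
  rfl

theorem map_fst_withDensity_prod {S : Type*} [MeasurableSpace S] {ν : Measure R} {κ : Measure S}
    [SFinite ν] [SFinite κ] {g : R × S → ℝ≥0∞} (hg : Measurable g) :
    ((ν.prod κ).withDensity g).map Prod.fst = ν.withDensity fun r => ∫⁻ s, g (r, s) ∂κ := by
  refine Measure.ext_of_lintegral _ fun F hF => ?_
  have hF' : Measurable fun z : R × S => F z.1 := hF.comp measurable_fst
  rw [lintegral_map hF measurable_fst, lintegral_withDensity_eq_lintegral_mul _ hg hF',
    lintegral_withDensity_eq_lintegral_mul _ hg.lintegral_prod_right' hF,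
    lintegral_prod _ (hg.mul hF').aemeasurable]
  refine lintegral_congr fun r => ?_
  simp only [Pi.mul_apply]
  exact lintegral_mul_const _ (hg.comp measurable_prodMk_left)

end PubLaw

/-! ### The transcript law as a flow for fixed public randomness -/

namespace Protocol

variable {𝒳 𝒴 R A B : Type*} [MeasurableSpace R] [MeasurableSpace A] [MeasurableSpace B]
  (P : Protocol 𝒳 𝒴 R A B)

instance : IsProbabilityMeasure P.pub := P.isProb_pub
instance : IsProbabilityMeasure P.privA := P.isProb_privA
instance : IsProbabilityMeasure P.privB := P.isProb_privB
instance : IsProbabilityMeasure P.coins := by unfold coins; infer_instance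

/-- Alice's conditional probability of transmitting `true`. -/
def aliceBit (x : 𝒳) (r : R) (h : List Bool) : ℝ :=
  partyBit P.turn Turn.alice (fun h => P.alice h x) P.privA r h

/-- Bob's conditional probability of transmitting `true`. -/
def bobBit (y : 𝒴) (r : R) (h : List Bool) : ℝ :=
  partyBit P.turn Turn.bob (fun h => P.bob h y) P.privB r h

/-- Conditional probability that the bit after the history `h` is received as `true`. -/
def nextBit (x : 𝒳) (y : 𝒴) (r : R) (h : List Bool) : ℝ :=
  if P.turn h r = Turn.alice then P.aliceBit x r h else P.bobBit y r h

/-- Probability of the history `h` given the public randomness. -/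
def flow (x : 𝒳) (y : 𝒴) (r : R) (h : List Bool) : ℝ≥0∞ :=
  partyReach P.turn Turn.alice (fun h => P.alice h x) P.privA r h *
    partyReach P.turn Turn.bob (fun h => P.bob h y) P.privB r h

theorem measurable_flow (x : 𝒳) (y : 𝒴) (h : List Bool) : Measurable fun r => P.flow x y r h :=
  (measurable_partyReach P.measurable_turn (fun h => P.measurable_alice h x) h).mul
    (measurable_partyReach P.measurable_turn (fun h => P.measurable_bob h y) h)

theorem nextBit_nonneg (x : 𝒳) (y : 𝒴) (r : R) (h : List Bool) : 0 ≤ P.nextBit x y r h := by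
  unfold nextBit
  split_ifs
  · exact partyBit_nonneg _ _
  · exact partyBit_nonneg _ _

theorem nextBit_le_one (x : 𝒳) (y : 𝒴) (r : R) (h : List Bool) : P.nextBit x y r h ≤ 1 := by
  unfold nextBit
  split_ifs
  · exact partyBit_le_one P.measurable_turn (fun h => P.measurable_alice h x) _ _
  · exact partyBit_le_one P.measurable_turn (fun h => P.measurable_bob h y) _ _

theorem flow_nil (x : 𝒳) (y : 𝒴) (r : R) : P.flow x y r [] = 1 := by
  simp [flow, partyReach_nil]

theorem flow_absorb (x : 𝒳) (y : 𝒴) {r : R} {h : List Bool} (hD : P.turn h r = Turn.done)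
    (c : Bool) : P.flow x y r (h ++ [c]) = 0 := by
  simp [flow, partyReach_absorb hD]

theorem flow_snoc (x : 𝒳) (y : 𝒴) {r : R} {h : List Bool} (hD : P.turn h r ≠ Turn.done)
    (c : Bool) : P.flow x y r (h ++ [c]) =
      P.flow x y r h * ENNReal.ofReal (bitProb (P.nextBit x y r h) c) := by
  unfold flow nextBit
  by_cases ht : P.turn h r = Turn.alice
  · rw [if_pos ht, partyReach_snoc P.measurable_turn (fun h => P.measurable_alice h x) hD ht,
      partyReach_pass hD (by simp [ht]), aliceBit]
    ring
  · have hb : P.turn h r = Turn.bob := by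
      cases h' : P.turn h r <;> simp_all
    rw [if_neg ht, partyReach_snoc P.measurable_turn (fun h => P.measurable_bob h y) hD hb,
      partyReach_pass hD ht, bobBit]
    ring

theorem isFlow_flow (x : 𝒳) (y : 𝒴) (r : R) :
    IsFlow (fun h => P.turn h r = Turn.done) (P.flow x y r) where
  root := P.flow_nil x y r
  add h hD := by
    have h0 := P.nextBit_nonneg x y r h
    have h1 := P.nextBit_le_one x y r h
    rw [P.flow_snoc x y hD, P.flow_snoc x y hD, ← mul_add,
      ← ENNReal.ofReal_add (bitProb_nonneg h0 h1 _) (bitProb_nonneg h0 h1 _)]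
    simp [bitProb]
  absorb _ hD c := P.flow_absorb x y hD c

theorem stepProb_eq (x : 𝒳) (y : 𝒴) (ω : R × A × B) (h : List Bool) (c : Bool) :
    P.stepProb x y ω h c =
      partyStep P.turn Turn.alice (fun h => P.alice h x) (ω.1, ω.2.1) h c *
        partyStep P.turn Turn.bob (fun h => P.bob h y) (ω.1, ω.2.2) h c := by
  unfold stepProb signal partyStep
  cases P.turn h ω.1 <;> simp

theorem reachProb_eq_pathProd (x : 𝒳) (y : 𝒴) (ω : R × A × B) (w : List Bool) :
    P.reachProb x y ω w = pathProd (P.stepProb x y ω) w := rfl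

theorem reachProb_eq (x : 𝒳) (y : 𝒴) (ω : R × A × B) (w : List Bool) :
    P.reachProb x y ω w =
      pathProd (partyStep P.turn Turn.alice (fun h => P.alice h x) (ω.1, ω.2.1)) w *
        pathProd (partyStep P.turn Turn.bob (fun h => P.bob h y) (ω.1, ω.2.2)) w := by
  rw [reachProb_eq_pathProd, ← pathProd_mul]
  congr 1
  funext h c
  exact P.stepProb_eq x y ω h c

theorem measurable_reachProb (x : 𝒳) (y : 𝒴) (w : List Bool) :
    Measurable fun ω => P.reachProb x y ω w := by
  simp only [P.reachProb_eq]
  refine Measurable.mul ?_ ?_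
  · exact (measurable_pathProd (fun h c => measurable_partyStep P.measurable_turn
      (fun h => P.measurable_alice h x) h c) w).comp
      (measurable_fst.prodMk (measurable_fst.comp measurable_snd))
  · exact (measurable_pathProd (fun h c => measurable_partyStep P.measurable_turn
      (fun h => P.measurable_bob h y) h c) w).comp
      (measurable_fst.prodMk (measurable_snd.comp measurable_snd))

/-- The rectangle property: for fixed public randomness each history has a factor depending on
Alice's coins and one depending on Bob's, and independence lets the averages multiply. Hence the
next bit has a law that its transmitter can compute alone. -/
theorem lintegral_reachProb (x : 𝒳) (y : 𝒴) (r : R) (w : List Bool) :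
    ∫⁻ s, P.reachProb x y (r, s) w ∂(P.privA.prod P.privB) = P.flow x y r w := by
  simp only [P.reachProb_eq]
  exact lintegral_prod_mul
    ((measurable_pathProd (fun h c => measurable_partyStep P.measurable_turn
      (fun h => P.measurable_alice h x) h c) w).comp measurable_prodMk_left).aemeasurable
    ((measurable_pathProd (fun h c => measurable_partyStep P.measurable_turn
      (fun h => P.measurable_bob h y) h c) w).comp measurable_prodMk_left).aemeasurable

theorem measurableSet_done (w : List Bool) : MeasurableSet {r | P.turn w r = Turn.done} :=
  P.measurable_turn w (measurableSet_singleton _)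

theorem transcriptLaw_eq_pubLaw (x : 𝒳) (y : 𝒴) :
    P.transcriptLaw x y = pubLaw P.pub fun w r => if P.turn w r = Turn.done then
      ∫⁻ s, P.reachProb x y (r, s) w ∂(P.privA.prod P.privB) else 0 := by
  unfold transcriptLaw pubLaw
  congr 1
  funext w
  have hm : Measurable fun ω => P.haltProb x y ω w :=
    Measurable.ite (measurable_fst (P.measurableSet_done w)) (P.measurable_reachProb x y w)
      measurable_const
  have e : (fun ω : R × A × B => (ω.1, w)) = (fun r : R => (r, w)) ∘ Prod.fst := rfl
  rw [e, ← Measure.map_map measurable_prodMk_right measurable_fst, coins,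
    map_fst_withDensity_prod hm]
  congr 2
  funext r
  simp only [haltProb]
  split_ifs <;> simp

theorem transcriptLaw_eq (x : 𝒳) (y : 𝒴) :
    P.transcriptLaw x y = pubLaw P.pub fun w r => if P.turn w r = Turn.done then
      P.flow x y r w else 0 := by
  simp only [P.transcriptLaw_eq_pubLaw, P.lintegral_reachProb]

end Protocol

/-! ### The simulating protocol: correctness and energy -/

section Measurability

variable {R : Type*} [MeasurableSpace R] {q : R → List Bool → ℝ}

theorem measurable_nextState (hq : ∀ h, Measurable fun r => q r h) (s : List Bool × ℕ) (c : Bool) :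
    Measurable fun r => nextState (q r) s c := by
  unfold nextState
  exact Measurable.ite ((measurable_digit s.2).comp (hq s.1) (measurableSet_singleton c))
    measurable_const measurable_const

theorem measurable_walkState (hq : ∀ h, Measurable fun r => q r h) (l : List Bool) :
    Measurable fun r => walkState (q r) l := by
  induction l using List.reverseRecOn with
  | nil => exact measurable_const
  | append_singleton l c ih =>
    simp only [walkState_snoc]
    exact measurable_comp_of_countable ih (g := fun s r => nextState (q r) s c)
      fun s => measurable_nextState hq s c

/-- The signal sent in the state `s` of a simulation by walks. -/
def walkSignal (p q : List Bool → ℝ) (s : List Bool × ℕ) : Signal :=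
  signalOfProb (walkProb (p s.1) (q s.1) s.2 true)

theorem measurable_walkSignal {p : R → List Bool → ℝ} (hp : ∀ h, Measurable fun r => p r h)
    (hq : ∀ h, Measurable fun r => q r h) (s : List Bool × ℕ) :
    Measurable fun r => walkSignal (p r) (q r) s :=
  measurable_signalOfProb.comp ((measurable_walkProb s.2 true).comp ((hp s.1).prodMk (hq s.1)))

end Measurability

namespace Protocol

variable {𝒳 𝒴 R A B : Type*} [MeasurableSpace R] [MeasurableSpace A] [MeasurableSpace B]
  (P : Protocol 𝒳 𝒴 R A B)

theorem measurable_aliceBit (x : 𝒳) (h : List Bool) : Measurable fun r => P.aliceBit x r h :=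
  measurable_partyBit P.measurable_turn (fun h => P.measurable_alice h x) h

theorem measurable_bobBit (y : 𝒴) (h : List Bool) : Measurable fun r => P.bobBit y r h :=
  measurable_partyBit P.measurable_turn (fun h => P.measurable_bob h y) h

/-- The protocol that sends each bit of `P` by a walk that starts at the prior probability `q`. -/
def walkSim (q : R → List Bool → ℝ) (hq : ∀ h, Measurable fun r => q r h) :
    Protocol 𝒳 𝒴 R A B where
  pub := P.pub
  privA := P.privA
  privB := P.privB
  isProb_pub := P.isProb_pub
  isProb_privA := P.isProb_privA
  isProb_privB := P.isProb_privB
  turn l r := P.turn (walkState (q r) l).1 r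
  alice l x z := walkSignal (P.aliceBit x z.1) (q z.1) (walkState (q z.1) l)
  bob l y z := walkSignal (P.bobBit y z.1) (q z.1) (walkState (q z.1) l)
  measurable_turn l := measurable_comp_of_countable (g := fun s r => P.turn s.1 r)
    (measurable_walkState hq l) fun s => P.measurable_turn s.1
  measurable_alice l x := (measurable_comp_of_countable
    (g := fun s r => walkSignal (P.aliceBit x r) (q r) s) (measurable_walkState hq l)
    (measurable_walkSignal (P.measurable_aliceBit x) hq)).comp measurable_fst
  measurable_bob l y := (measurable_comp_of_countable
    (g := fun s r => walkSignal (P.bobBit y r) (q r) s) (measurable_walkState hq l)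
    (measurable_walkSignal (P.measurable_bobBit y) hq)).comp measurable_fst

variable {q : R → List Bool → ℝ} (hq : ∀ h, Measurable fun r => q r h)

theorem signal_walkSim (x : 𝒳) (y : 𝒴) (ω : R × A × B) (l : List Bool) :
    (P.walkSim q hq).signal x y ω l = if P.turn (walkState (q ω.1) l).1 ω.1 = Turn.done then none
      else some (walkSignal (P.nextBit x y ω.1) (q ω.1) (walkState (q ω.1) l)) := by
  unfold signal walkSim walkSignal nextBit
  cases P.turn (walkState (q ω.1) l).1 ω.1 <;> simp

theorem isWalkSim (hq0 : ∀ r h, 0 < q r h) (hq1 : ∀ r h, q r h < 1) (x : 𝒳) (y : 𝒴)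
    (ω : R × A × B) :
    IsWalkSim (fun h => P.turn h ω.1 = Turn.done) (P.nextBit x y ω.1) (q ω.1) (P.flow x y ω.1)
      ((P.walkSim q hq).reachProb x y ω) where
  p_nonneg := P.nextBit_nonneg x y ω.1
  p_le_one := P.nextBit_le_one x y ω.1
  q_pos := hq0 ω.1
  q_lt_one := hq1 ω.1
  u_nil := P.flow_nil x y ω.1
  u_snoc _ hD := P.flow_snoc x y hD
  u_absorb _ hD := P.flow_absorb x y hD
  ρ_nil := by simp [reachProb_eq_pathProd]
  ρ_snoc l hD c := by
    rw [reachProb_eq_pathProd, pathProd_snoc, ← reachProb_eq_pathProd, stepProb, signal_walkSim,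
      if_neg hD]
    rfl
  ρ_absorb l hD c := by
    rw [reachProb_eq_pathProd, pathProd_snoc, stepProb, signal_walkSim, if_pos hD]
    simp

/-- The simulation determines the transcript of the simulated protocol. -/
def decode (q : R → List Bool → ℝ) (v : R × List Bool) : R × List Bool :=
  (v.1, (walkState (q v.1) v.2).1)

include hq in
theorem measurable_decode : Measurable (decode q) := by
  refine measurable_from_prod_countable_left fun l => ?_
  exact measurable_id.prodMk (measurable_fst.comp (measurable_walkState hq l))

/-- `decode` keeps the public randomness, so the laws can be compared for each value of it, where
`IsWalkSim.tsum_halt` gives every complete transcript its exact probability. -/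
theorem map_transcriptLaw_walkSim (hq0 : ∀ r h, 0 < q r h) (hq1 : ∀ r h, q r h < 1) (x : 𝒳)
    (y : 𝒴) :
    ((P.walkSim q hq).transcriptLaw x y).map (decode q) = P.transcriptLaw x y := by
  refine Measure.ext_of_lintegral _ fun F hF => ?_
  have hF' := hF.comp (measurable_decode hq)
  rw [lintegral_map hF (measurable_decode hq), transcriptLaw_eq_pubLaw, transcriptLaw_eq]
  have hm1 : ∀ w, Measurable fun r => if (P.walkSim q hq).turn w r = Turn.done then
      ∫⁻ s, (P.walkSim q hq).reachProb x y (r, s) w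
        ∂((P.walkSim q hq).privA.prod (P.walkSim q hq).privB) else 0 := fun w =>
    Measurable.ite ((P.walkSim q hq).measurableSet_done w)
      ((P.walkSim q hq).measurable_reachProb x y w).lintegral_prod_right' measurable_const
  have hm2 : ∀ w, Measurable fun r => if P.turn w r = Turn.done then P.flow x y r w else 0 :=
    fun w => Measurable.ite (P.measurableSet_done w) (P.measurable_flow x y w) measurable_const
  have e := lintegral_pubLaw (ν := (P.walkSim q hq).pub) hm1 hF'
  simp only [Function.comp_def] at e
  rw [e, lintegral_pubLaw hm2 hF]
  refine lintegral_congr fun r => ?_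
  have hms : ∀ l, Measurable fun s => (P.walkSim q hq).reachProb x y (r, s) l := fun l =>
    ((P.walkSim q hq).measurable_reachProb x y l).comp measurable_prodMk_left
  have hmul : ∀ l (a : ℝ≥0∞), AEMeasurable (fun s => (P.walkSim q hq).reachProb x y (r, s) l * a)
      (P.privA.prod P.privB) := fun l a => ((hms l).mul_const a).aemeasurable
  have e1 : ∀ l, (if (P.walkSim q hq).turn l r = Turn.done then
      ∫⁻ s, (P.walkSim q hq).reachProb x y (r, s) l
        ∂((P.walkSim q hq).privA.prod (P.walkSim q hq).privB) else 0) * F (decode q (r, l)) =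
      ∫⁻ s, (P.walkSim q hq).reachProb x y (r, s) l * (if P.turn (walkState (q r) l).1 r = Turn.done
        then F (r, (walkState (q r) l).1) else 0) ∂(P.privA.prod P.privB) := by
    intro l
    rw [lintegral_mul_const _ (hms l)]
    change (if P.turn (walkState (q r) l).1 r = Turn.done then _ else _) * _ = _
    split_ifs
    · rfl
    · simp
  simp only [e1]
  rw [← lintegral_tsum fun l => hmul l _]
  have e2 : ∀ s, ∑' l, (P.walkSim q hq).reachProb x y (r, s) l *
      (if P.turn (walkState (q r) l).1 r = Turn.done then F (r, (walkState (q r) l).1) else 0) =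
      ∑' w, (if P.turn w r = Turn.done then P.flow x y r w else 0) * F (r, w) := by
    intro s
    have H := P.isWalkSim hq hq0 hq1 x y (r, s)
    have e3 : ∀ w, (if P.turn w r = Turn.done then P.flow x y r w else 0) * F (r, w) =
        ∑' l, (if (walkState (q r) l).1 = w then (P.walkSim q hq).reachProb x y (r, s) l else 0) *
          (if P.turn w r = Turn.done then F (r, w) else 0) := by
      intro w
      rw [ENNReal.tsum_mul_right]
      split_ifs with hD
      · rw [H.tsum_halt hD]
      · simp
    simp only [e3]
    rw [ENNReal.tsum_comm]
    refine tsum_congr fun l => ?_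
    rw [tsum_eq_single (walkState (q r) l).1]
    · simp
    · intro w hw
      simp [hw.symm]
  simp only [e2, lintegral_const, measure_univ, mul_one]

/-- A push-forward keeps the total mass, so termination of the walks needs no separate argument. -/
theorem halts_of_simulates {R' A' B' : Type*} [MeasurableSpace R'] [MeasurableSpace A']
    [MeasurableSpace B'] {φ : Protocol 𝒳 𝒴 R' A' B'} (hs : φ.Simulates P) (hP : P.Halts) :
    φ.Halts := by
  obtain ⟨g, hg, h⟩ := hs
  intro x y
  rw [← hP x y, ← h x y, Measure.map_apply hg MeasurableSet.univ, Set.preimage_univ]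

theorem energyCost_walkSim_le (hq0 : ∀ r h, 0 < q r h) (hq1 : ∀ r h, q r h < 1) (x : 𝒳) (y : 𝒴)
    {K : R → ℝ≥0∞} (hK : Measurable K)
    (hle : ∀ᵐ r ∂P.pub, ∑' h, (if P.turn h r = Turn.done then 0 else
      P.flow x y r h * ENNReal.ofReal (6 * binKL (P.nextBit x y r h) (q r h))) ≤ K r) :
    (P.walkSim q hq).energyCost x y ≤ ∫⁻ r, K r ∂P.pub := by
  have hsig : ∀ l, Measurable fun ω : R × A × B =>
      (((P.walkSim q hq).signal x y ω l).map Signal.energy).getD 0 := by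
    intro l
    have e : (fun ω : R × A × B => (((P.walkSim q hq).signal x y ω l).map Signal.energy).getD 0) =
        fun ω => if (P.walkSim q hq).turn l ω.1 = Turn.done then 0 else
          if (P.walkSim q hq).turn l ω.1 = Turn.alice then
            ((P.walkSim q hq).alice l x (ω.1, ω.2.1)).energy
          else ((P.walkSim q hq).bob l y (ω.1, ω.2.2)).energy := by
      funext ω
      unfold signal
      cases (P.walkSim q hq).turn l ω.1 <;> simp
    rw [e]
    have ht : Measurable fun ω : R × A × B => (P.walkSim q hq).turn l ω.1 :=
      ((P.walkSim q hq).measurable_turn l).comp measurable_fst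
    exact Measurable.ite (ht (measurableSet_singleton _)) measurable_const
      (Measurable.ite (ht (measurableSet_singleton _))
      (Signal.measurable_energy.comp (((P.walkSim q hq).measurable_alice l x).comp
        (measurable_fst.prodMk (measurable_fst.comp measurable_snd))))
      (Signal.measurable_energy.comp (((P.walkSim q hq).measurable_bob l y).comp
        (measurable_fst.prodMk (measurable_snd.comp measurable_snd)))))
  unfold energyCost
  have hm : ∀ l, AEMeasurable (fun ω => (P.walkSim q hq).reachProb x y ω l *
      (((P.walkSim q hq).signal x y ω l).map Signal.energy).getD 0) (P.walkSim q hq).coins :=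
    fun l => (((P.walkSim q hq).measurable_reachProb x y l).mul (hsig l)).aemeasurable
  rw [← lintegral_tsum hm]
  have hfst : MeasurePreserving Prod.fst P.coins P.pub := measurePreserving_fst
  rw [← hfst.lintegral_comp hK]
  refine lintegral_mono_ae ?_
  filter_upwards [hfst.quasiMeasurePreserving.ae hle] with ω hω
  refine le_trans (le_trans (le_of_eq ?_)
    (P.isWalkSim hq hq0 hq1 x y ω).tsum_energy_le) (le_trans (le_of_eq ?_) hω)
  · refine tsum_congr fun l => ?_
    rw [signal_walkSim]
    split_ifs <;> rfl
  · refine tsum_congr fun h => ?_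
    congr 1

end Protocol

/-! ### Mutual information as an average divergence -/

section Mixture

variable {S V : Type*} [MeasurableSpace S] [MeasurableSingletonClass S] [MeasurableSpace V]

/-- The joint law of an index drawn from `μ` and of a point drawn from the law with that index. -/
def mixture (μ : PMF S) (T : S → Measure V) : Measure (S × V) :=
  Measure.sum fun s => μ s • (T s).map fun v => (s, v)

omit [MeasurableSingletonClass S] in
theorem lintegral_mixture (μ : PMF S) (T : S → Measure V) {F : S × V → ℝ≥0∞} (hF : Measurable F) :
    ∫⁻ z, F z ∂(mixture μ T) = ∑' s, μ s * ∫⁻ v, F (s, v) ∂(T s) := by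
  rw [mixture, lintegral_sum_measure]
  refine tsum_congr fun s => ?_
  rw [lintegral_smul_measure, lintegral_map hF measurable_prodMk_left, smul_eq_mul]

variable (μ : PMF S) (T : S → Measure V) [∀ s, IsProbabilityMeasure (T s)]

instance : IsProbabilityMeasure (mixture μ T) := by
  constructor
  rw [← lintegral_one, lintegral_mixture μ T measurable_const]
  simp [μ.tsum_coe]

omit [∀ s, IsProbabilityMeasure (T s)] in
theorem mixture_singleton_prod (s : S) {E : Set V} (hE : MeasurableSet E) :
    mixture μ T ({s} ×ˢ E) = μ s * T s E := by
  have hm : MeasurableSet ({s} ×ˢ E) := (measurableSet_singleton s).prod hE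
  rw [mixture, Measure.sum_apply _ hm, tsum_eq_single s]
  · rw [Measure.smul_apply, Measure.map_apply measurable_prodMk_left hm, smul_eq_mul]
    congr 2
    ext v
    simp
  · intro t ht
    rw [Measure.smul_apply, Measure.map_apply measurable_prodMk_left hm]
    have : (fun v => (t, v)) ⁻¹' ({s} ×ˢ E) = ∅ := by
      ext v
      simp [ht]
    simp [this]

theorem mixture_map_fst_singleton (s : S) : (mixture μ T).map Prod.fst {s} = μ s := by
  rw [Measure.map_apply measurable_fst (measurableSet_singleton s)]
  have : (Prod.fst ⁻¹' {s} : Set (S × V)) = {s} ×ˢ Set.univ := by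
    ext z
    simp
  rw [this, mixture_singleton_prod μ T s MeasurableSet.univ, measure_univ, mul_one]

/-- The average divergence of the members of a mixture from the mean is at most the mutual
information (in nats) of the index and the point. -/
theorem tsum_klDiv_le :
    ∑' s, μ s * klDiv (T s) ((mixture μ T).map Prod.snd) ≤
      klDiv (mixture μ T) (((mixture μ T).map Prod.fst).prod ((mixture μ T).map Prod.snd)) := by
  set J := mixture μ T with hJ
  set ν := J.map Prod.fst
  set M := J.map Prod.snd
  have : IsProbabilityMeasure ν := Measure.isProbabilityMeasure_map measurable_fst.aemeasurable
  have : IsProbabilityMeasure M := Measure.isProbabilityMeasure_map measurable_snd.aemeasurable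
  by_cases hac : J ≪ ν.prod M
  swap
  · rw [InformationTheory.klDiv_of_not_ac hac]
    exact le_top
  rw [InformationTheory.klDiv_eq_lintegral_klFun_of_ac hac]
  set g := J.rnDeriv (ν.prod M) with hg
  have hgm : Measurable g := Measure.measurable_rnDeriv _ _
  have hgs : ∀ s, Measurable fun v => g (s, v) := fun s => hgm.comp measurable_prodMk_left
  -- Over an atom of `μ`, the slice of the joint density is the density of that member with respect
  -- to the mean.
  have hT : ∀ s, μ s ≠ 0 → T s = M.withDensity fun v => g (s, v) := by
    intro s hs
    refine Measure.ext fun E hE => ?_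
    have h1 := mixture_singleton_prod μ T s hE
    rw [← hJ, ← Measure.withDensity_rnDeriv_eq J (ν.prod M) hac, ← hg, withDensity_apply _
      ((measurableSet_singleton s).prod hE), ← Measure.prod_restrict,
      lintegral_prod _ hgm.aemeasurable, Measure.restrict_singleton, lintegral_smul_measure,
      lintegral_dirac' _ hgm.lintegral_prod_right', mixture_map_fst_singleton, smul_eq_mul] at h1
    rw [withDensity_apply _ hE]
    exact ((ENNReal.mul_right_inj hs (μ.apply_ne_top s)).1 h1).symm
  have hk : Measurable fun z => ENNReal.ofReal (klFun (g z).toReal) := by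
    have := measurable_klFun
    fun_prop
  rw [lintegral_prod _ hk.aemeasurable]
  -- The index set may be uncountable; on the countable support of `μ` the integral becomes a sum.
  have hsub : Function.support (fun s => μ s * klDiv (T s) M) ⊆ μ.support := by
    intro s hs
    rw [Function.mem_support] at hs
    exact (μ.mem_support_iff s).2 (left_ne_zero_of_mul hs)
  rw [← tsum_subtype_eq_of_support_subset hsub]
  refine le_trans (le_of_eq ?_) (setLIntegral_le_lintegral μ.support _)
  rw [lintegral_countable _ μ.support_countable]
  refine tsum_congr fun s => ?_
  rw [mixture_map_fst_singleton, mul_comm]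
  congr 1
  have hTs := hT s ((μ.mem_support_iff _).1 s.2)
  have hacs : T s ≪ M := by
    rw [hTs]
    exact withDensity_absolutelyContinuous _ _
  rw [InformationTheory.klDiv_eq_lintegral_klFun_of_ac hacs]
  refine lintegral_congr_ae ?_
  have hr := Measure.rnDeriv_withDensity M (hgs s)
  rw [← hTs] at hr
  filter_upwards [hr] with v hv
  rw [hv]

end Mixture

/-! ### The chain rule for one bit with a perturbed prior -/

section EntropyStep

theorem neg_log_one_sub_le {δ : ℝ} (h0 : 0 ≤ δ) (h1 : δ ≤ 1 / 2) : -Real.log (1 - δ) ≤ 2 * δ := by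
  have h := Real.one_sub_inv_le_log_of_pos (x := 1 - δ) (by linarith)
  have h2 : (1 - δ)⁻¹ ≤ 1 + 2 * δ := by
    rw [inv_le_comm₀ (by linarith) (by linarith), inv_le_iff_one_le_mul₀ (by linarith)]
    nlinarith
  linarith

/-- The prior enters only through `-log q`, so a lower bound on `q` suffices. With `q` replaced by
it, the logarithm splits into child minus parent and `-log (1 - δ) ≤ 2 * δ`. -/
theorem mul_log_div_le {u m p b q δ : ℝ} (hu : 0 < u) (hm : 0 < m) (hb : 0 ≤ b) (hp : 0 ≤ p)
    (h0 : 0 ≤ δ) (h1 : δ ≤ 1 / 2) (hq : (1 - δ) * (b / m) ≤ q) (hbp : b = 0 → u * p = 0) :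
    u * (p * Real.log (p / q)) ≤
      u * p * Real.log (u * p / b) - u * p * Real.log (u / m) + u * p * (2 * δ) := by
  rcases hp.eq_or_lt with rfl | hp
  · simp
  have hb : 0 < b := hb.lt_of_ne fun h => (mul_pos hu hp).ne' (hbp h.symm)
  have hδ : 0 < 1 - δ := by linarith
  have hq' : 0 < (1 - δ) * (b / m) := by positivity
  have hq0 : 0 < q := hq'.trans_le hq
  have e1 : Real.log (p / q) ≤ Real.log (p / ((1 - δ) * (b / m))) :=
    Real.log_le_log (by positivity) (by gcongr)
  have e2 : p / ((1 - δ) * (b / m)) = (u * p / b) / (u / m) / (1 - δ) := by field_simp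
  have e5 : Real.log ((u * p / b) / (u / m) / (1 - δ)) =
      Real.log (u * p / b) - Real.log (u / m) - Real.log (1 - δ) := by
    rw [Real.log_div (by positivity) hδ.ne', Real.log_div (by positivity) (by positivity)]
  rw [e2, e5] at e1
  have e3 := neg_log_one_sub_le h0 h1
  have e4 : Real.log (p / q) ≤ Real.log (u * p / b) - Real.log (u / m) + 2 * δ := by linarith
  have := mul_le_mul_of_nonneg_left e4 (by positivity : 0 ≤ u * p)
  linarith

/-- The divergence of one bit from a slightly perturbed prior is bounded by the increment of
relative entropy. -/
theorem mul_binKL_add_relEnt_le {u m₀ m₁ p δ : ℝ} (hu : 0 ≤ u) (hm₀ : 0 ≤ m₀) (hm₁ : 0 ≤ m₁)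
    (hp0 : 0 ≤ p) (hp1 : p ≤ 1) (h0 : 0 ≤ δ) (h1 : δ ≤ 1 / 2) (hz₀ : m₀ = 0 → u * (1 - p) = 0)
    (hz₁ : m₁ = 0 → u * p = 0) :
    u * binKL p ((1 - δ) * (m₁ / (m₀ + m₁)) + δ / 2) + relEnt u (m₀ + m₁) ≤
      relEnt (u * (1 - p)) m₀ + relEnt (u * p) m₁ + u * (2 * δ) := by
  rcases hu.eq_or_lt with rfl | hu
  · simp [relEnt]
  have hm : 0 < m₀ + m₁ := by
    refine (add_nonneg hm₀ hm₁).lt_of_ne fun h => hu.ne' ?_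
    have e0 := hz₀ (by linarith)
    have e1 := hz₁ (by linarith)
    linarith
  have e1 := mul_log_div_le (q := (1 - δ) * (m₁ / (m₀ + m₁)) + δ / 2) hu hm hm₁ hp0 h0 h1
    (by linarith) hz₁
  -- The perturbation mixes in a fair coin with weight `δ`, so each of the two bits keeps at least
  -- `1 - δ` times its mean probability.
  have hq : (1 - δ) * (m₀ / (m₀ + m₁)) ≤ 1 - ((1 - δ) * (m₁ / (m₀ + m₁)) + δ / 2) := by
    have : m₀ / (m₀ + m₁) = 1 - m₁ / (m₀ + m₁) := by field_simp; ring
    rw [this]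
    linarith
  have e0 := mul_log_div_le hu hm hm₀ (by linarith : 0 ≤ 1 - p) h0 h1 hq hz₀
  unfold binKL relEnt
  linarith

end EntropyStep

/-! ### Averaging over the inputs and the total energy -/

namespace Protocol

variable {𝒳 𝒴 R A B : Type*} [MeasurableSpace R] [MeasurableSpace A] [MeasurableSpace B]
  (P : Protocol 𝒳 𝒴 R A B) (μ : PMF (𝒳 × 𝒴))

/-- Probability of the history `h` given the public randomness, for inputs drawn from `μ`. -/
def meanFlow (r : R) (h : List Bool) : ℝ≥0∞ :=
  ∑' s : μ.support, μ s * P.flow s.1.1 s.1.2 r h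

theorem tsum_support_coe {S : Type*} (μ : PMF S) : ∑' s : μ.support, μ s = 1 := by
  rw [← μ.tsum_coe]
  exact tsum_subtype_support μ

/-- The definition sums over the support of `μ` because measurability in `r` needs a countable index
set. -/
theorem meanFlow_eq (r : R) (h : List Bool) :
    P.meanFlow μ r h = ∑' s, μ s * P.flow s.1 s.2 r h :=
  tsum_subtype_eq_of_support_subset (f := fun s => μ s * P.flow s.1 s.2 r h) fun s hs =>
    (μ.mem_support_iff s).2 (left_ne_zero_of_mul (Function.mem_support.1 hs))

theorem measurable_meanFlow (h : List Bool) : Measurable fun r => P.meanFlow μ r h := by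
  have : Countable μ.support := μ.support_countable.to_subtype
  exact Measurable.tsum fun s => (P.measurable_flow _ _ h).const_mul _

theorem isFlow_meanFlow (r : R) :
    IsFlow (fun h => P.turn h r = Turn.done) (P.meanFlow μ r) where
  root := by simp [meanFlow, flow_nil, tsum_support_coe]
  add h hD := by
    unfold meanFlow
    rw [← ENNReal.tsum_add]
    refine tsum_congr fun s => ?_
    rw [← mul_add, (P.isFlow_flow s.1.1 s.1.2 r).add h hD]
  absorb h hD c := by simp [meanFlow, P.flow_absorb _ _ hD]

theorem flow_eq_zero_of_meanFlow {s : 𝒳 × 𝒴} (hs : μ s ≠ 0) {r : R} {h : List Bool}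
    (h0 : P.meanFlow μ r h = 0) : P.flow s.1 s.2 r h = 0 := by
  rw [meanFlow_eq, ENNReal.tsum_eq_zero] at h0
  exact (mul_eq_zero.1 (h0 s)).resolve_left hs

theorem measurable_leaf {F : List Bool → R → ℝ≥0∞} (hF : ∀ w, Measurable (F w)) (w : List Bool) :
    Measurable fun r => if P.turn w r = Turn.done then F w r else 0 :=
  Measurable.ite (P.measurableSet_done w) (hF w) measurable_const

theorem measurable_leafSum {F : List Bool → R → ℝ≥0∞} (hF : ∀ w, Measurable (F w)) :
    Measurable fun r => leafSum (fun h => P.turn h r = Turn.done) (fun w => F w r) [] := by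
  refine Measurable.tsum fun w => ?_
  convert! P.measurable_leaf hF w

theorem leafSum_root_eq (F : List Bool → R → ℝ≥0∞) (r : R) :
    leafSum (fun h => P.turn h r = Turn.done) (fun w => F w r) [] =
      ∑' w, if P.turn w r = Turn.done then F w r else 0 := by
  unfold leafSum
  refine tsum_congr fun w => ?_
  simp only [List.nil_append]

variable {P}

theorem Halts.isProbabilityMeasure (hP : P.Halts) (x : 𝒳) (y : 𝒴) :
    IsProbabilityMeasure (P.transcriptLaw x y) := ⟨hP x y⟩

/-- The leaf mass never exceeds one, and by termination its integral is one. -/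
theorem Halts.leafSum_flow (hP : P.Halts) (x : 𝒳) (y : 𝒴) :
    ∀ᵐ r ∂P.pub, leafSum (fun h => P.turn h r = Turn.done) (P.flow x y r) [] = 1 := by
  have hint : ∫⁻ r, leafSum (fun h => P.turn h r = Turn.done) (P.flow x y r) [] ∂P.pub = 1 := by
    rw [← hP x y, ← lintegral_one, transcriptLaw_eq,
      lintegral_pubLaw (P.measurable_leaf (P.measurable_flow x y)) measurable_const]
    refine lintegral_congr fun r => ?_
    rw [P.leafSum_root_eq (fun w r => P.flow x y r w)]
    simp
  have hle : ∀ r, leafSum (fun h => P.turn h r = Turn.done) (P.flow x y r) [] ≤ 1 := fun r =>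
    ((P.isFlow_flow x y r).leafSum_le []).trans (P.flow_nil x y r).le
  refine ae_eq_of_ae_le_of_lintegral_le (g := fun _ => 1) (.of_forall hle) (by simp [hint])
    aemeasurable_const ?_
  rw [hint]
  simp

theorem Halts.leafSum_meanFlow (hP : P.Halts) :
    ∀ᵐ r ∂P.pub, leafSum (fun h => P.turn h r = Turn.done) (P.meanFlow μ r) [] = 1 := by
  have : Countable μ.support := μ.support_countable.to_subtype
  have h := ae_all_iff.2 fun s : μ.support => hP.leafSum_flow s.1.1 s.1.2
  filter_upwards [h] with r hr
  rw [P.leafSum_root_eq (fun w r => P.meanFlow μ r w)]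
  have e : ∀ w, (if P.turn w r = Turn.done then P.meanFlow μ r w else 0) = ∑' s : μ.support,
      μ s * if P.turn w r = Turn.done then P.flow s.1.1 s.1.2 r w else 0 := by
    intro w
    split_ifs
    · rfl
    · simp
  simp only [e]
  rw [ENNReal.tsum_comm, ← tsum_support_coe μ]
  refine tsum_congr fun s => ?_
  rw [ENNReal.tsum_mul_left, ← P.leafSum_root_eq (fun w r => P.flow s.1.1 s.1.2 r w), hr s, mul_one]

variable (P)

/-- The law of the public randomness and the transcript for inputs drawn from `μ`. -/
def meanLaw : Measure (R × List Bool) :=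
  pubLaw P.pub fun w r => if P.turn w r = Turn.done then P.meanFlow μ r w else 0

theorem map_snd_mixture [MeasurableSpace 𝒳] [DiscreteMeasurableSpace 𝒳] [MeasurableSpace 𝒴]
    [DiscreteMeasurableSpace 𝒴] :
    (mixture μ fun s => P.transcriptLaw s.1 s.2).map Prod.snd = P.meanLaw μ := by
  refine Measure.ext_of_lintegral _ fun F hF => ?_
  have hF' : Measurable fun z : (𝒳 × 𝒴) × R × List Bool => F z.2 := hF.comp measurable_snd
  have : Countable μ.support := μ.support_countable.to_subtype
  rw [lintegral_map hF measurable_snd, lintegral_mixture _ _ hF', meanLaw,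
    lintegral_pubLaw (P.measurable_leaf (P.measurable_meanFlow μ)) hF]
  have hm : ∀ s : 𝒳 × 𝒴, Measurable fun r => ∑' w,
      (if P.turn w r = Turn.done then P.flow s.1 s.2 r w else 0) * F (r, w) := fun s =>
    Measurable.tsum fun w => (P.measurable_leaf (P.measurable_flow s.1 s.2) w).mul
      (hF.comp measurable_prodMk_right)
  have e1 : ∀ s : 𝒳 × 𝒴, μ s * ∫⁻ v, F v ∂(P.transcriptLaw s.1 s.2) =
      ∫⁻ r, μ s * ∑' w, (if P.turn w r = Turn.done then P.flow s.1 s.2 r w else 0) * F (r, w)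
        ∂P.pub := by
    intro s
    rw [transcriptLaw_eq, lintegral_pubLaw (P.measurable_leaf (P.measurable_flow s.1 s.2)) hF,
      lintegral_const_mul _ (hm s)]
  simp only [e1]
  rw [← tsum_subtype_eq_of_support_subset (s := μ.support)]
  · rw [← lintegral_tsum fun s : μ.support => ((hm s).const_mul (μ s)).aemeasurable]
    refine lintegral_congr fun r => ?_
    simp only [← ENNReal.tsum_mul_left]
    rw [ENNReal.tsum_comm]
    refine tsum_congr fun w => ?_
    simp only [← mul_assoc]
    rw [ENNReal.tsum_mul_right]
    congr 1
    split_ifs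
    · rfl
    · simp
  · intro s hs
    rw [Function.mem_support] at hs
    refine (μ.mem_support_iff s).2 fun h0 => hs ?_
    simp [h0]

variable {P}

/-- Lower bound of the divergence of a transcript law from the mean law by the relative entropies
at the leaves. -/
theorem Halts.lintegral_leafSum_le (hP : P.Halts) {s : 𝒳 × 𝒴} (hs : μ s ≠ 0) :
    ∫⁻ r, leafSum (fun h => P.turn h r = Turn.done) (fun w => ENNReal.ofReal
      (relEnt (P.flow s.1 s.2 r w).toReal (P.meanFlow μ r w).toReal)) [] ∂P.pub ≤
      klDiv (P.transcriptLaw s.1 s.2) (P.meanLaw μ) := by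
  have := hP.isProbabilityMeasure s.1 s.2
  have hMm := P.measurable_leaf (P.measurable_meanFlow μ)
  have : IsFiniteMeasure (P.meanLaw μ) := by
    constructor
    rw [meanLaw, ← lintegral_one, lintegral_pubLaw hMm measurable_const]
    have hle : ∀ r, ∑' w, (if P.turn w r = Turn.done then P.meanFlow μ r w else 0) * 1 ≤ 1 := by
      intro r
      simp only [mul_one]
      rw [← P.leafSum_root_eq (fun w r => P.meanFlow μ r w)]
      exact ((P.isFlow_meanFlow μ r).leafSum_le []).trans (P.isFlow_meanFlow μ r).root.le
    exact (lintegral_mono hle).trans_lt (by simp)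
  -- This is the density of the transcript law with respect to the mean law: since `μ s ≠ 0`, the
  -- flow vanishes wherever the mean flow does.
  set f : R × List Bool → ℝ≥0∞ := fun v => P.flow s.1 s.2 v.1 v.2 / P.meanFlow μ v.1 v.2 with hf
  have hfm : Measurable f := measurable_from_prod_countable_left fun w =>
    (P.measurable_flow s.1 s.2 w).div (P.measurable_meanFlow μ w)
  have hT : P.transcriptLaw s.1 s.2 = (P.meanLaw μ).withDensity f := by
    refine Measure.ext_of_lintegral _ fun F hF => ?_
    rw [lintegral_withDensity_eq_lintegral_mul _ hfm hF, meanLaw,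
      lintegral_pubLaw hMm (hfm.mul hF), transcriptLaw_eq,
      lintegral_pubLaw (P.measurable_leaf (P.measurable_flow s.1 s.2)) hF]
    refine lintegral_congr fun r => tsum_congr fun w => ?_
    split_ifs
    · simp only [Pi.mul_apply, hf]
      rw [← mul_assoc, ENNReal.mul_div_cancel' (P.flow_eq_zero_of_meanFlow μ hs)
        (fun h => absurd h ((P.isFlow_meanFlow μ r).ne_top w))]
    · simp
  have hac : P.transcriptLaw s.1 s.2 ≪ P.meanLaw μ := by
    rw [hT]
    exact withDensity_absolutelyContinuous _ _
  have hr := Measure.rnDeriv_withDensity (P.meanLaw μ) hfm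
  rw [← hT] at hr
  have hkl : klDiv (P.transcriptLaw s.1 s.2) (P.meanLaw μ) =
      ∫⁻ v, ENNReal.ofReal (klFun (f v).toReal) ∂(P.meanLaw μ) := by
    rw [InformationTheory.klDiv_eq_lintegral_klFun_of_ac hac]
    refine lintegral_congr_ae ?_
    filter_upwards [hr] with v hv
    rw [hv]
  have hk : Measurable fun v => ENNReal.ofReal (klFun (f v).toReal) := by
    have := measurable_klFun
    fun_prop
  rw [hkl, meanLaw, lintegral_pubLaw hMm hk]
  refine lintegral_mono fun r => ?_
  rw [P.leafSum_root_eq (fun w r => ENNReal.ofReal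
    (relEnt (P.flow s.1 s.2 r w).toReal (P.meanFlow μ r w).toReal))]
  refine ENNReal.tsum_le_tsum fun w => ?_
  split_ifs with hD
  · have hM := (P.isFlow_meanFlow μ r).ne_top w
    by_cases h0 : P.meanFlow μ r w = 0
    · simp [h0, P.flow_eq_zero_of_meanFlow μ hs h0, relEnt]
    · have h0' : (P.meanFlow μ r w).toReal ≠ 0 := ENNReal.toReal_ne_zero.2 ⟨h0, hM⟩
      -- The terms agree because `relEnt u m = m * klFun (u / m)`.
      nth_rewrite 2 [← ENNReal.ofReal_toReal hM]
      rw [← ENNReal.ofReal_mul ENNReal.toReal_nonneg]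
      refine (congrArg ENNReal.ofReal ?_).le
      simp only [hf, ENNReal.toReal_div, InformationTheory.klFun_apply, relEnt]
      field_simp
  · simp

section Prior

variable (P)

/-- The conditional probability of the bit `true` for inputs drawn from `μ`, perturbed so that it
lies strictly between `0` and `1`. -/
def prior (e : ℝ) (r : R) (h : List Bool) : ℝ :=
  (1 - e * 2⁻¹ ^ (h.length + 2)) * ((P.meanFlow μ r (h ++ [true])).toReal /
    ((P.meanFlow μ r (h ++ [false])).toReal + (P.meanFlow μ r (h ++ [true])).toReal)) +
  e * 2⁻¹ ^ (h.length + 2) / 2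

theorem measurable_prior (e : ℝ) (h : List Bool) : Measurable fun r => P.prior μ e r h := by
  have h1 := fun h => P.measurable_meanFlow μ h
  unfold prior
  fun_prop

variable {e : ℝ} (he0 : 0 < e) (he1 : e ≤ 1)
include he0 he1

omit he0 in
-- The exponent `k + 2` is chosen so that twice the perturbation is `e * 2⁻¹ ^ (k + 1)`, which
-- `IsFlow.tsum_geometric_le` sums to at most `e`.
theorem perturbation_le (k : ℕ) : e * 2⁻¹ ^ (k + 2) ≤ 1 / 2 := by
  have h1 : (2⁻¹ : ℝ) ^ (k + 2) ≤ 2⁻¹ ^ 1 :=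
    pow_le_pow_of_le_one (by norm_num) (by norm_num) (by omega)
  have h2 : e * 2⁻¹ ^ (k + 2) ≤ 1 * 2⁻¹ ^ (k + 2) := by gcongr
  rw [pow_one] at h1
  linarith

theorem prior_mem (r : R) (h : List Bool) : 0 < P.prior μ e r h ∧ P.prior μ e r h < 1 := by
  have hδ := perturbation_le he1 h.length
  have hδ0 : 0 < e * 2⁻¹ ^ (h.length + 2) := by positivity
  unfold prior
  set δ := e * 2⁻¹ ^ (h.length + 2)
  set b := (P.meanFlow μ r (h ++ [true])).toReal /
    ((P.meanFlow μ r (h ++ [false])).toReal + (P.meanFlow μ r (h ++ [true])).toReal)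
  have hb0 : 0 ≤ b := by positivity
  have hb1 : b ≤ 1 := div_le_one_of_le₀
    (le_add_of_nonneg_left ENNReal.toReal_nonneg) (by positivity)
  constructor <;> nlinarith

/-- This is `mul_binKL_add_relEnt_le` at one node, in the form of the hypothesis of
`IsFlow.tsum_cost_le`. -/
theorem flow_mul_binKL_le {s : 𝒳 × 𝒴} (hs : μ s ≠ 0) {r : R} {h : List Bool}
    (hD : P.turn h r ≠ Turn.done) :
    P.flow s.1 s.2 r h * ENNReal.ofReal (binKL (P.nextBit s.1 s.2 r h) (P.prior μ e r h)) +
      ENNReal.ofReal (relEnt (P.flow s.1 s.2 r h).toReal (P.meanFlow μ r h).toReal) ≤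
    ENNReal.ofReal (relEnt (P.flow s.1 s.2 r (h ++ [false])).toReal
      (P.meanFlow μ r (h ++ [false])).toReal) +
    ENNReal.ofReal (relEnt (P.flow s.1 s.2 r (h ++ [true])).toReal
      (P.meanFlow μ r (h ++ [true])).toReal) +
    ENNReal.ofReal e * (P.flow s.1 s.2 r h * 2⁻¹ ^ (h.length + 1)) := by
  have hu := P.isFlow_flow s.1 s.2 r
  have hm := P.isFlow_meanFlow μ r
  have hp0 := P.nextBit_nonneg s.1 s.2 r h
  have hp1 := P.nextBit_le_one s.1 s.2 r h
  obtain ⟨hq0, hq1⟩ := P.prior_mem μ he0 he1 r h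
  have hum : ∀ h, (P.meanFlow μ r h).toReal = 0 → (P.flow s.1 s.2 r h).toReal = 0 := by
    intro h h0
    rw [ENNReal.toReal_eq_zero_iff] at h0
    rw [P.flow_eq_zero_of_meanFlow μ hs (h0.resolve_right (hm.ne_top h)), ENNReal.toReal_zero]
  have hrel : ∀ h, 0 ≤ relEnt (P.flow s.1 s.2 r h).toReal (P.meanFlow μ r h).toReal := fun h =>
    relEnt_nonneg ENNReal.toReal_nonneg ENNReal.toReal_nonneg (hum h)
  have hsn : ∀ c, (P.flow s.1 s.2 r (h ++ [c])).toReal =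
      (P.flow s.1 s.2 r h).toReal * bitProb (P.nextBit s.1 s.2 r h) c := by
    intro c
    rw [P.flow_snoc _ _ hD, ENNReal.toReal_mul, ENNReal.toReal_ofReal (bitProb_nonneg hp0 hp1 c)]
  have hsum : (P.meanFlow μ r h).toReal = (P.meanFlow μ r (h ++ [false])).toReal +
      (P.meanFlow μ r (h ++ [true])).toReal := by
    rw [← hm.add h hD, ENNReal.toReal_add (hm.ne_top _) (hm.ne_top _)]
  have hkl : 0 ≤ binKL (P.nextBit s.1 s.2 r h) (P.prior μ e r h) := by
    rw [binKL_eq_klFun hq0 hq1]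
    have h1 : 0 < 1 - P.prior μ e r h := by linarith
    have h2 : 0 ≤ 1 - P.nextBit s.1 s.2 r h := by linarith
    have h3 := klFun_nonneg (div_nonneg hp0 hq0.le)
    have h4 := klFun_nonneg (div_nonneg h2 h1.le)
    positivity
  have hz : ∀ c, (P.meanFlow μ r (h ++ [c])).toReal = 0 →
      (P.flow s.1 s.2 r h).toReal * bitProb (P.nextBit s.1 s.2 r h) c = 0 := fun c h0 => by
    rw [← hsn, hum _ h0]
  have key := mul_binKL_add_relEnt_le (u := (P.flow s.1 s.2 r h).toReal) ENNReal.toReal_nonneg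
    ENNReal.toReal_nonneg ENNReal.toReal_nonneg hp0 hp1
    (by positivity : 0 ≤ e * 2⁻¹ ^ (h.length + 2)) (perturbation_le he1 h.length)
    (hz false) (hz true)
  have hf := hsn false
  have ht := hsn true
  have hrf := hrel (h ++ [false])
  have hrt := hrel (h ++ [true])
  simp only [bitProb, if_true, Bool.false_eq_true, if_false] at hf ht
  rw [← hf, ← ht, ← hsum] at key
  have hpr : P.prior μ e r h = (1 - e * 2⁻¹ ^ (h.length + 2)) *
      ((P.meanFlow μ r (h ++ [true])).toReal / (P.meanFlow μ r h).toReal) +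
      e * 2⁻¹ ^ (h.length + 2) / 2 := by
    rw [hsum]
    rfl
  rw [← hpr] at key
  have eerr : ENNReal.ofReal e * (P.flow s.1 s.2 r h * 2⁻¹ ^ (h.length + 1)) =
      ENNReal.ofReal ((P.flow s.1 s.2 r h).toReal * (2 * (e * 2⁻¹ ^ (h.length + 2)))) := by
    have e2 : (2⁻¹ : ℝ≥0∞) = ENNReal.ofReal 2⁻¹ := by
      rw [ENNReal.ofReal_inv_of_pos two_pos, ENNReal.ofReal_ofNat]
    have e3 : (P.flow s.1 s.2 r h).toReal * (2 * (e * 2⁻¹ ^ (h.length + 2))) =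
        e * ((P.flow s.1 s.2 r h).toReal * 2⁻¹ ^ (h.length + 1)) := by
      rw [pow_succ _ (h.length + 1)]
      ring
    rw [e3, ENNReal.ofReal_mul he0.le, ENNReal.ofReal_mul ENNReal.toReal_nonneg,
      ENNReal.ofReal_toReal (hu.ne_top h), ENNReal.ofReal_pow (by norm_num), e2]
  rw [eerr]
  nth_rewrite 1 [← ENNReal.ofReal_toReal (hu.ne_top h)]
  rw [← ENNReal.ofReal_mul ENNReal.toReal_nonneg,
    ← ENNReal.ofReal_add (mul_nonneg ENNReal.toReal_nonneg hkl) (hrel h),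
    ← ENNReal.ofReal_add hrf hrt, ← ENNReal.ofReal_add (by positivity) (by positivity)]
  exact ENNReal.ofReal_le_ofReal key

variable {P}

/-- For almost every public string both flows put full mass on the leaves, so the entropy
telescopes. Input pairs of mass zero are excluded, as their flow need not vanish with the mean flow.
-/
theorem Halts.energyCost_walkSim_prior_le (hP : P.Halts) {s : 𝒳 × 𝒴} (hs : μ s ≠ 0) :
    (P.walkSim (P.prior μ e) (P.measurable_prior μ e)).energyCost s.1 s.2 ≤
      6 * (klDiv (P.transcriptLaw s.1 s.2) (P.meanLaw μ) + ENNReal.ofReal e) := by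
  have hmeas : ∀ w, Measurable fun r => ENNReal.ofReal
      (relEnt (P.flow s.1 s.2 r w).toReal (P.meanFlow μ r w).toReal) := by
    intro w
    have h1 := P.measurable_flow s.1 s.2 w
    have h2 := P.measurable_meanFlow μ w
    unfold relEnt
    fun_prop
  have hL := P.measurable_leafSum hmeas
  refine (P.energyCost_walkSim_le (P.measurable_prior μ e)
    (fun r h => (P.prior_mem μ he0 he1 r h).1) (fun r h => (P.prior_mem μ he0 he1 r h).2) s.1 s.2
    ((hL.add_const (ENNReal.ofReal e)).const_mul 6) ?_).trans ?_
  · filter_upwards [hP.leafSum_flow s.1 s.2, hP.leafSum_meanFlow μ] with r hr1 hr2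
    have hu := P.isFlow_flow s.1 s.2 r
    have key := hu.tsum_cost_le (P.isFlow_meanFlow μ r) hr1 hr2
      (fun h => P.flow_eq_zero_of_meanFlow μ hs)
      (fun h hD => P.flow_mul_binKL_le μ he0 he1 hs hD)
    rw [ENNReal.tsum_mul_left] at key
    refine le_trans (le_of_eq ?_) (mul_le_mul_right (key.trans (add_le_add le_rfl
      (mul_le_of_le_one_right zero_le hu.tsum_geometric_le))) 6)
    rw [← ENNReal.tsum_mul_left]
    refine tsum_congr fun h => ?_
    split_ifs
    · simp
    · rw [ENNReal.ofReal_mul (by norm_num), ENNReal.ofReal_ofNat]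
      ring
  · rw [lintegral_const_mul _ (hL.add_const _), lintegral_add_right _ measurable_const]
    simp only [lintegral_const, measure_univ, mul_one]
    gcongr
    exact hP.lintegral_leafSum_le μ hs

theorem Halts.distEnergyCost_walkSim_prior_le [MeasurableSpace 𝒳] [DiscreteMeasurableSpace 𝒳]
    [MeasurableSpace 𝒴] [DiscreteMeasurableSpace 𝒴] (hP : P.Halts) :
    (P.walkSim (P.prior μ e) (P.measurable_prior μ e)).distEnergyCost μ ≤
      6 * (P.extInfoCost μ + ENNReal.ofReal e) := by
  have := fun s : 𝒳 × 𝒴 => hP.isProbabilityMeasure s.1 s.2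
  have hkl := tsum_klDiv_le μ fun s : 𝒳 × 𝒴 => P.transcriptLaw s.1 s.2
  -- Passing from nats to bits divides by `log 2 ≤ 1`, which only increases the bound.
  have hinfo : klDiv (P.jointLaw μ)
      (((P.jointLaw μ).map Prod.fst).prod ((P.jointLaw μ).map Prod.snd)) ≤ P.extInfoCost μ := by
    unfold extInfoCost mutualInfo
    refine ENNReal.le_div_iff_mul_le (Or.inl ?_) (Or.inl ENNReal.ofReal_ne_top) |>.2 ?_
    · simpa using Real.log_pos one_lt_two
    · refine mul_le_of_le_one_right zero_le ?_
      simpa using Real.log_two_lt_d9.le.trans (by norm_num)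
  rw [P.map_snd_mixture μ] at hkl
  have hkl' : ∑' s : 𝒳 × 𝒴, μ s * klDiv (P.transcriptLaw s.1 s.2) (P.meanLaw μ) ≤
      P.extInfoCost μ := by
    refine hkl.trans (le_trans (le_of_eq ?_) hinfo)
    rw [← P.map_snd_mixture μ]
    rfl
  calc (P.walkSim (P.prior μ e) (P.measurable_prior μ e)).distEnergyCost μ
      ≤ ∑' s : 𝒳 × 𝒴, μ s *
        (6 * (klDiv (P.transcriptLaw s.1 s.2) (P.meanLaw μ) + ENNReal.ofReal e)) := by
        refine ENNReal.tsum_le_tsum fun s => ?_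
        by_cases hs : μ s = 0
        · simp [hs]
        · exact mul_le_mul_right (hP.energyCost_walkSim_prior_le μ he0 he1 hs) _
    _ = 6 * (∑' s : 𝒳 × 𝒴, μ s * klDiv (P.transcriptLaw s.1 s.2) (P.meanLaw μ) +
        ENNReal.ofReal e) := by
        have h1 : ENNReal.ofReal e = ∑' s, μ s * ENNReal.ofReal e := by
          rw [ENNReal.tsum_mul_right, μ.tsum_coe, one_mul]
        nth_rewrite 2 [h1]
        rw [← ENNReal.tsum_add, ← ENNReal.tsum_mul_left]
        refine tsum_congr fun s => ?_
        ring
    _ ≤ _ := by gcongr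

end Prior

end Protocol

end VarBSC

end

/-! ### The theorem -/

theorem theorem4p2 :
    ∃ C : NNReal,
      ∀ (𝒳 : Type*) (𝒴 : Type*) (R : Type*) (A : Type*) (B : Type*)
        [MeasurableSpace 𝒳] [DiscreteMeasurableSpace 𝒳]
        [MeasurableSpace 𝒴] [DiscreteMeasurableSpace 𝒴]
        [MeasurableSpace R] [MeasurableSpace A] [MeasurableSpace B]
        (π : VarBSC.Protocol 𝒳 𝒴 R A B) (_ : π.IsNoiseless) (_ : π.Halts)
        (μ : PMF (𝒳 × 𝒴)) (n : ℕ) (_ : 0 < n),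
        ∃ φ : VarBSC.Protocol 𝒳 𝒴 R A B,
          φ.Halts ∧ φ.Simulates π ∧
            φ.distEnergyCost μ ≤
              (C : ENNReal) * (π.extInfoCost μ + 1 / (2 * (n : ENNReal))) := by
  -- The constant comes from the energy of a single walk, `6 * binKL p q`; the later steps do not
  -- enlarge it.
  refine ⟨6, ?_⟩
  intro 𝒳 𝒴 R A B _ _ _ _ _ _ _ π _ hπ μ n hn
  have hn' : (1 : ℝ) ≤ n := by exact_mod_cast hn
  -- The perturbation scale `e` is `ε` itself; all that matters is `0 < e ≤ 1`.
  have he0 : (0 : ℝ) < 1 / (2 * n) := by positivity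
  have he1 : (1 : ℝ) / (2 * n) ≤ 1 := by
    rw [div_le_one (by positivity)]
    linarith
  have hsim : (π.walkSim (π.prior μ _) (π.measurable_prior μ _)).Simulates π :=
    ⟨_, VarBSC.Protocol.measurable_decode (π.measurable_prior μ _),
      π.map_transcriptLaw_walkSim (π.measurable_prior μ _)
        (fun r h => (π.prior_mem μ he0 he1 r h).1) fun r h => (π.prior_mem μ he0 he1 r h).2⟩
  refine ⟨_, π.halts_of_simulates hsim hπ, hsim, ?_⟩
  have h := hπ.distEnergyCost_walkSim_prior_le μ he0 he1
  have e : ENNReal.ofReal (1 / (2 * n)) = 1 / (2 * (n : ENNReal)) := by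
    rw [ENNReal.ofReal_div_of_pos (by positivity), ENNReal.ofReal_mul zero_le_two,
      ENNReal.ofReal_one, ENNReal.ofReal_ofNat, ENNReal.ofReal_natCast]
  rw [e] at h
  simpa using h
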